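/- For a graph $H$, let $\mathrm{ex}(n,H)$ denote the maximum number of edges in an $n$-vertex simple graph that does not contain $H$ as a (not necessarily induced) subgraph. Let $K_{3,25}'$ be the $1$-subdivision of the complete bipartite graph $K_{3,25}$, that is, the graph obtained from $K_{3,25}$ by replacing its edges by internally disjoint paths of length $2$. Then $$\mathrm{ex}(n,K_{3,25}')=\Theta(n^{4/3})\qquad (n\to\infty),$$ that is, there are constants $c,C>0$ and $n_0$ such that $c\,n^{4/3}\le \mathrm{ex}(n,K_{3,25}')\le C\,n^{4/3}$ for all integers $n\ge n_0$. -/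

import Mathlib

open Filter Asymptotics

/-- The `1`-subdivision of a graph `G`: its vertices are the vertices of `G` (the branch vertices)
together with one new vertex for every edge of `G`, and its edges join the new vertex of each edge
`e` to the two endpoints of `e`. Thus every edge `uv` of `G` is replaced by a path `u - e - v` of
length two, and these paths are internally disjoint. -/
def oneSubdivision {V : Type*} (G : SimpleGraph V) : SimpleGraph (V ⊕ G.edgeSet) where
  Adj
    | Sum.inl v, Sum.inr e => v ∈ (e : Sym2 V)
    | Sum.inr e, Sum.inl v => v ∈ (e : Sym2 V)
    | Sum.inl _, Sum.inl _ => False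
    | Sum.inr _, Sum.inr _ => False
  symm := ⟨by rintro (v | e) (w | f) h <;> exact h⟩
  loopless := ⟨by rintro (v | e) h <;> exact h⟩

/-! ### Algebra: counting points linked to three given points. -/

/-- `Linked P x Q` says that `P` and `Q` have a common neighbour with first coordinate `x` in the
graph in which `(a, b, c)` and `(x, y, z)` are adjacent when `b + z = a² x` and `c + y = a x²`. -/
def Linked {F : Type*} [Field F] (P : F × F × F) (x : F) (Q : F × F × F) : Prop :=
  Q.1 ≠ P.1 ∧ Q.2.1 - P.2.1 = (Q.1 ^ 2 - P.1 ^ 2) * x ∧ Q.2.2 - P.2.2 = (Q.1 - P.1) * x ^ 2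

/-- `Q` is linked to each of three points, through distinct first coordinates. -/
def TripleLinked {F : Type*} [Field F] (P₁ P₂ P₃ Q : F × F × F) : Prop :=
  ∃ x y z, x ≠ y ∧ x ≠ z ∧ y ≠ z ∧ Linked P₁ x Q ∧ Linked P₂ y Q ∧ Linked P₃ z Q

/-- No two and no four elements of `A` sum to zero. -/
structure SumFree {F : Type*} [Field F] (A : Set F) : Prop where
  two : ∀ a ∈ A, ∀ b ∈ A, a + b ≠ 0
  four : ∀ a ∈ A, ∀ b ∈ A, ∀ c ∈ A, ∀ d ∈ A, a + b + c + d ≠ 0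

section TripleLinked

variable {F : Type*} [Field F]

theorem TripleLinked.swap₁₂ {P₁ P₂ P₃ Q : F × F × F} (h : TripleLinked P₁ P₂ P₃ Q) :
    TripleLinked P₂ P₁ P₃ Q := by
  obtain ⟨x, y, z, h1, h2, h3, h4, h5, h6⟩ := h
  exact ⟨y, x, z, h1.symm, h3, h2, h5, h4, h6⟩

theorem TripleLinked.swap₂₃ {P₁ P₂ P₃ Q : F × F × F} (h : TripleLinked P₁ P₂ P₃ Q) :
    TripleLinked P₁ P₃ P₂ Q := by
  obtain ⟨x, y, z, h1, h2, h3, h4, h5, h6⟩ := h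
  exact ⟨x, z, y, h2, h1, h3.symm, h4, h6, h5⟩

theorem TripleLinked.rotate {P₁ P₂ P₃ Q : F × F × F} (h : TripleLinked P₁ P₂ P₃ Q) :
    TripleLinked P₂ P₃ P₁ Q := h.swap₁₂.swap₂₃

/-- The link to the second point eliminates `y` as `(c - c₂)(a - a₂)(a + a₂)² = (b - b₂)²`.
Substituting `b` and `c` from the first link leaves a quadratic in `x` whose coefficients depend
only on `a` and the two points. -/
theorem linked_quadratic {a₁ b₁ c₁ a₂ b₂ c₂ a b c x y : F}
    (h₁ : Linked (a₁, b₁, c₁) x (a, b, c)) (h₂ : Linked (a₂, b₂, c₂) y (a, b, c)) :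
    (a - a₁) * ((a₂ - a₁) * (a ^ 2 - (a₁ + a₂) * a - (a₁ ^ 2 + a₁ * a₂ + a₂ ^ 2))) * x ^ 2
      + 2 * (b₂ - b₁) * (a ^ 2 - a₁ ^ 2) * x
      = (c₂ - c₁) * ((a - a₂) * (a + a₂) ^ 2) + (b₂ - b₁) ^ 2 := by
  obtain ⟨-, hb₁, hc₁⟩ := h₁
  obtain ⟨-, hb₂, hc₂⟩ := h₂
  simp only at hb₁ hc₁ hb₂ hc₂
  have e : (c - c₂) * ((a - a₂) * (a + a₂) ^ 2) = (b - b₂) ^ 2 := by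
    linear_combination (a - a₂) * (a + a₂) ^ 2 * hc₂ - (b - b₂ + (a ^ 2 - a₂ ^ 2) * y) * hb₂
  obtain rfl : b = b₁ + (a ^ 2 - a₁ ^ 2) * x := by linear_combination hb₁
  obtain rfl : c = c₁ + (a - a₁) * x ^ 2 := by linear_combination hc₁
  linear_combination e

open Polynomial in
/-- A finite set of points whose first coordinates are roots of a fixed polynomial and whose fibres
over the first coordinate are small. -/
theorem card_le_of_poly {S : Finset (F × F × F)} {R : F[X]} {d k : ℕ} (hR : R ≠ 0)
    (hd : R.natDegree ≤ d) (hS : ∀ Q ∈ S, R.eval Q.1 = 0)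
    (hf : ∀ a, ∀ T ⊆ S, (∀ Q ∈ T, Q.1 = a) → T.card ≤ k) : S.card ≤ k * d := by
  classical
  refine (Finset.card_le_mul_card_image_of_maps_to (f := Prod.fst) (t := R.roots.toFinset)
    (fun Q hQ => ?_) k fun a _ => ?_).trans ?_
  · rw [Multiset.mem_toFinset, mem_roots hR]
    exact hS Q hQ
  · exact hf a _ (Finset.filter_subset _ _) fun Q hQ => (Finset.mem_filter.1 hQ).2
  · exact Nat.mul_le_mul_left k ((Multiset.toFinset_card_le _).trans ((card_roots' R).trans hd))

open Polynomial in
/-- Points over the same first coordinate that are linked to `P₁` are determined by the link. -/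
theorem card_fibre_le {P₁ : F × F × F} {a : F} {T : Finset (F × F × F)} {R : F[X]} {k : ℕ}
    (hR : R ≠ 0) (hd : R.natDegree ≤ k)
    (hT : ∀ Q ∈ T, Q.1 = a ∧ ∃ x, Linked P₁ x Q ∧ R.eval x = 0) : T.card ≤ k := by
  classical
  choose! hTa x hx using hT
  refine (Finset.card_le_card_of_injOn x (t := R.roots.toFinset) (fun Q hQ => ?_) ?_).trans
    ((Multiset.toFinset_card_le _).trans ((card_roots' R).trans hd))
  · simp only [Finset.mem_coe, Multiset.mem_toFinset, mem_roots hR]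
    exact (hx Q hQ).2
  · intro Q hQ Q' hQ' h
    obtain ⟨⟨-, h1, h2⟩, -⟩ := hx Q hQ
    obtain ⟨⟨-, h1', h2'⟩, -⟩ := hx Q' hQ'
    have e := (hTa Q hQ).trans (hTa Q' hQ').symm
    refine Prod.ext e (Prod.ext ?_ ?_)
    · have : Q.2.1 - P₁.2.1 = Q'.2.1 - P₁.2.1 := by rw [h1, h1', h, e]
      linear_combination this
    · have : Q.2.2 - P₁.2.2 = Q'.2.2 - P₁.2.2 := by rw [h2, h2', h, e]
      linear_combination this

open Polynomial in
theorem quadratic_ne_zero {p q r : F} (h : p ≠ 0 ∨ q ≠ 0) :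
    (C p * X ^ 2 + C q * X - C r : F[X]) ≠ 0 := by
  intro e
  have h2 := congrArg (coeff · 2) e
  have h1 := congrArg (coeff · 1) e
  simp [coeff_C] at h1 h2
  tauto

open Polynomial in
theorem natDegree_quadratic_sub_le (p q r : F) :
    (C p * X ^ 2 + C q * X - C r : F[X]).natDegree ≤ 2 := by
  compute_degree

variable {A : Set F}

theorem SumFree.two_ne_zero (hA : SumFree A) {a : F} (ha : a ∈ A) : (2 : F) ≠ 0 := by
  intro h
  refine hA.two a ha a ha ?_
  linear_combination a * h

theorem SumFree.sq_sub_sq_ne_zero (hA : SumFree A) {a b : F} (ha : a ∈ A) (hb : b ∈ A)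
    (h : a ≠ b) : a ^ 2 - b ^ 2 ≠ 0 := by
  rw [sq_sub_sq]
  exact mul_ne_zero (hA.two a ha b hb) (sub_ne_zero.2 h)

open Polynomial in
/-- The resultant of the two quadratic equations, as a polynomial in the first coordinate. -/
noncomputable def resultantPoly (P₁ P₂ P₃ : F × F × F) : F[X] :=
  let A (P : F × F × F) : F[X] := C (P.1 - P₁.1) * (X ^ 2 - C (P₁.1 + P.1) * X
    - C (P₁.1 ^ 2 + P₁.1 * P.1 + P.1 ^ 2))
  let B (P : F × F × F) : F[X] := C (P.2.1 - P₁.2.1)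
  let D (P : F × F × F) : F[X] := C (P.2.2 - P₁.2.2) * ((X - C P.1) * (X + C P.1) ^ 2) + B P ^ 2
  (A P₂ * D P₃ - A P₃ * D P₂) ^ 2 + 4 * ((X - C P₁.1) * (X + C P₁.1) ^ 2)
    * (A P₂ * B P₃ - A P₃ * B P₂) * (B P₂ * D P₃ - B P₃ * D P₂)

open Polynomial in
-- The true resultant has a further factor `(X - P₁.1) ^ 2`, which is divided out in
-- `resultantPoly`. Since `A`, `B`, `D` have degrees at most 2, 0, 3, the two summands have degrees
-- at most `2 * 5` and `3 + 2 + 3`.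
theorem natDegree_resultantPoly (P₁ P₂ P₃ : F × F × F) :
    (resultantPoly P₁ P₂ P₃).natDegree ≤ 10 := by
  have hA (u v w : F) : (C u * (X ^ 2 - C v * X - C w)).natDegree ≤ 2 := by compute_degree
  have hB (u : F) : (C u).natDegree ≤ 0 := by simp
  have hD (u v w : F) : (C u * ((X - C v) * (X + C v) ^ 2) + C w ^ 2).natDegree ≤ 3 := by
    compute_degree
  have hm {p q : F[X]} {m n : ℕ} (hp : p.natDegree ≤ m) (hq : q.natDegree ≤ n) :
      (p * q).natDegree ≤ m + n := natDegree_mul_le_of_le hp hq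
  have hs {p q : F[X]} {m : ℕ} (hp : p.natDegree ≤ m) (hq : q.natDegree ≤ m) :
      (p - q).natDegree ≤ m := natDegree_sub_le_of_le hp hq |>.trans (by simp)
  unfold resultantPoly
  refine natDegree_add_le_of_degree_le ?_ (le_trans (b := 8) ?_ (by norm_num))
  · rw [sq]
    exact hm (m := 5) (n := 5) (hs (hm (hA _ _ _) (hD _ _ _)) (hm (hA _ _ _) (hD _ _ _)))
      (hs (hm (hA _ _ _) (hD _ _ _)) (hm (hA _ _ _) (hD _ _ _)))
  · refine hm (m := 5) (n := 3) (hm (m := 3) (n := 2) ?_ ?_) ?_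
    · compute_degree
    · exact hs (hm (hA _ _ _) (hB _)) (hm (hA _ _ _) (hB _))
    · exact (hs (hm (hB _) (hD _ _ _)) (hm (hB _) (hD _ _ _)))

theorem TripleLinked.eval_resultantPoly {P₁ P₂ P₃ Q : F × F × F} (h : TripleLinked P₁ P₂ P₃ Q) :
    (resultantPoly P₁ P₂ P₃).eval Q.1 = 0 := by
  obtain ⟨x, y, z, -, -, -, h1, h2, h3⟩ := h
  have e2 := linked_quadratic h1 h2
  have e3 := linked_quadratic h1 h3
  simp only [resultantPoly, Polynomial.eval_add, Polynomial.eval_mul, Polynomial.eval_pow,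
    Polynomial.eval_sub, Polynomial.eval_C, Polynomial.eval_X, Polynomial.eval_ofNat]
  rw [← e2, ← e3]
  ring

open Polynomial in
-- With `a` fixed, `x` is a root of a quadratic that is not identically zero, and `x` determines the
-- point.
theorem card_fibre_le_of_linked {P₁ P₂ : F × F × F} {a : F}
    (hne : (a - P₁.1) * ((P₂.1 - P₁.1) * (a ^ 2 - (P₁.1 + P₂.1) * a
      - (P₁.1 ^ 2 + P₁.1 * P₂.1 + P₂.1 ^ 2))) ≠ 0 ∨
      2 * (P₂.2.1 - P₁.2.1) * (a ^ 2 - P₁.1 ^ 2) ≠ 0)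
    {T : Finset (F × F × F)} (hT : ∀ Q ∈ T, Q.1 = a ∧ ∃ x y, Linked P₁ x Q ∧ Linked P₂ y Q) :
    T.card ≤ 2 := by
  refine card_fibre_le (P₁ := P₁) (a := a) (quadratic_ne_zero
    (r := (P₂.2.2 - P₁.2.2) * ((a - P₂.1) * (a + P₂.1) ^ 2) + (P₂.2.1 - P₁.2.1) ^ 2) hne)
    (natDegree_quadratic_sub_le _ _ _) fun Q hQ => ?_
  obtain ⟨rfl, x, y, h1, h2⟩ := hT Q hQ
  refine ⟨rfl, x, h1, ?_⟩
  simp only [eval_sub, eval_add, eval_mul, eval_C, eval_X, eval_pow]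
  linear_combination linked_quadratic h1 h2

/-- Distinct first coordinates: at most two triply linked points over each first coordinate. -/
theorem card_fibre_le_two (hA : SumFree A) {P₁ P₂ P₃ : F × F × F} (h₁ : P₁.1 ∈ A) (h₂ : P₂.1 ∈ A)
    (h₃ : P₃.1 ∈ A) (h₁₂ : P₁.1 ≠ P₂.1) (h₁₃ : P₁.1 ≠ P₃.1) (h₂₃ : P₂.1 ≠ P₃.1)
    {T : Finset (F × F × F)} (hT : ∀ Q ∈ T, Q.1 ∈ A ∧ TripleLinked P₁ P₂ P₃ Q) (a : F)
    (ha : ∀ Q ∈ T, Q.1 = a) : T.card ≤ 2 := by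
  obtain rfl | ⟨Q₀, hQ₀⟩ := T.eq_empty_or_nonempty
  · simp
  have haA : a ∈ A := ha Q₀ hQ₀ ▸ (hT Q₀ hQ₀).1
  have ha₁ : a - P₁.1 ≠ 0 := by
    obtain ⟨x, y, z, -, -, -, h1, h2, h3⟩ := (hT Q₀ hQ₀).2
    exact sub_ne_zero.2 (ha Q₀ hQ₀ ▸ h1.1)
  -- The two leading coefficients differ by `(P₃.1 - P₂.1)(a + P₁.1 + P₂.1 + P₃.1)`; this is where
  -- four elements of `A` must not sum to zero.
  have key : a ^ 2 - (P₁.1 + P₂.1) * a - (P₁.1 ^ 2 + P₁.1 * P₂.1 + P₂.1 ^ 2) ≠ 0 ∨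
      a ^ 2 - (P₁.1 + P₃.1) * a - (P₁.1 ^ 2 + P₁.1 * P₃.1 + P₃.1 ^ 2) ≠ 0 := by
    by_contra! h
    have : (P₃.1 - P₂.1) * (a + P₁.1 + P₂.1 + P₃.1) = 0 := by
      linear_combination h.1 - h.2
    exact mul_ne_zero (sub_ne_zero.2 h₂₃.symm) (hA.four _ haA _ h₁ _ h₂ _ h₃) this
  obtain key | key := key
  · refine card_fibre_le_of_linked (P₂ := P₂)
      (Or.inl (mul_ne_zero ha₁ (mul_ne_zero (sub_ne_zero.2 h₁₂.symm) key))) fun Q hQ => ⟨ha Q hQ, ?_⟩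
    obtain ⟨x, y, z, -, -, -, h1, h2, h3⟩ := (hT Q hQ).2
    exact ⟨x, y, h1, h2⟩
  · refine card_fibre_le_of_linked (P₂ := P₃)
      (Or.inl (mul_ne_zero ha₁ (mul_ne_zero (sub_ne_zero.2 h₁₃.symm) key))) fun Q hQ => ⟨ha Q hQ, ?_⟩
    obtain ⟨x, y, z, -, -, -, h1, h2, h3⟩ := (hT Q hQ).2
    exact ⟨x, z, h1, h3⟩

/-- The slope through which two points would be linked. -/
def slope₂ (P Q : F × F × F) : F := (Q.2.1 - P.2.1) / (Q.1 ^ 2 - P.1 ^ 2)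

theorem slope₂_comm (P Q : F × F × F) : slope₂ P Q = slope₂ Q P := by
  rw [slope₂, slope₂, ← neg_sub, ← neg_sub (P.1 ^ 2), neg_div_neg_eq]

/-- Generic case: if the triple fails to satisfy the closing condition at `P₂`, there are at most
twenty triply linked points. -/
theorem card_le_of_not_closed (hA : SumFree A) {P₁ P₂ P₃ : F × F × F} (h₁ : P₁.1 ∈ A)
    (h₂ : P₂.1 ∈ A) (h₃ : P₃.1 ∈ A) (h₁₂ : P₁.1 ≠ P₂.1) (h₁₃ : P₁.1 ≠ P₃.1) (h₂₃ : P₂.1 ≠ P₃.1)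
    {S : Finset (F × F × F)} (hS : ∀ Q ∈ S, Q.1 ∈ A ∧ TripleLinked P₁ P₂ P₃ Q)
    (hc : P₃.2.2 - P₁.2.2 ≠
      (P₂.1 - P₁.1) * slope₂ P₁ P₂ ^ 2 + (P₃.1 - P₂.1) * slope₂ P₂ P₃ ^ 2) : S.card ≤ 20 := by
  refine card_le_of_poly (k := 2) (R := resultantPoly P₁ P₂ P₃) ?_ (natDegree_resultantPoly _ _ _)
    (fun Q hQ => (hS Q hQ).2.eval_resultantPoly) fun a T hT ha =>
      card_fibre_le_two hA h₁ h₂ h₃ h₁₂ h₁₃ h₂₃ (fun Q hQ => hS Q (hT hQ)) a ha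
  intro h0
  -- At `X = P₂.1` the cubic factor of `D P₂` vanishes, and the polynomial collapses to a perfect
  -- square: the defect in `hc` times nonzero factors, squared.
  have ev := congrArg (Polynomial.eval P₂.1) h0
  have n12 := hA.sq_sub_sq_ne_zero h₂ h₁ h₁₂.symm
  have n23 := hA.sq_sub_sq_ne_zero h₃ h₂ h₂₃.symm
  have e12 : P₂.2.1 - P₁.2.1 = (P₂.1 ^ 2 - P₁.1 ^ 2) * slope₂ P₁ P₂ := by
    rw [slope₂, mul_div_cancel₀ _ n12]
  have e23 : P₃.2.1 - P₂.2.1 = (P₃.1 ^ 2 - P₂.1 ^ 2) * slope₂ P₂ P₃ := by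
    rw [slope₂, mul_div_cancel₀ _ n23]
  generalize slope₂ P₁ P₂ = x at *
  generalize slope₂ P₂ P₃ = y at *
  have e13 : P₃.2.1 - P₁.2.1 = (P₂.1 ^ 2 - P₁.1 ^ 2) * x + (P₃.1 ^ 2 - P₂.1 ^ 2) * y := by
    linear_combination e12 + e23
  simp only [resultantPoly, Polynomial.eval_add, Polynomial.eval_mul, Polynomial.eval_pow,
    Polynomial.eval_sub, Polynomial.eval_C, Polynomial.eval_X, Polynomial.eval_ofNat,
    Polynomial.eval_zero, e12, e13] at ev
  have : ((P₂.1 - P₁.1) * (P₂.1 + P₁.1) ^ 2 * ((P₂.1 - P₃.1) * (P₂.1 + P₃.1) ^ 2) *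
      (P₃.2.2 - P₁.2.2 - ((P₂.1 - P₁.1) * x ^ 2 + (P₃.1 - P₂.1) * y ^ 2))) ^ 2 = 0 := by
    linear_combination ev
  refine pow_ne_zero 2 ?_ this
  have s12 := hA.two _ h₂ _ h₁
  have s23 := hA.two _ h₂ _ h₃
  exact mul_ne_zero (mul_ne_zero (mul_ne_zero (sub_ne_zero.2 h₁₂.symm) (pow_ne_zero 2 s12))
    (mul_ne_zero (sub_ne_zero.2 h₂₃) (pow_ne_zero 2 s23))) (sub_ne_zero.2 hc)

/-- When the two points are themselves linked through `u`, the quadratic for `x` has `u` as a root.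
Distinctness of `x` and `y` excludes that root, so dividing by `x - u` leaves a linear equation. -/
theorem linked_conjugate (hA : SumFree A) {a₁ a₂ b₁ b₂ c₁ c₂ u a b c x y : F} (h₂ : a₂ ∈ A)
    (ha : a ∈ A) (h₁₂ : a₁ ≠ a₂) (hxy : x ≠ y)
    (hb : b₂ - b₁ = (a₂ ^ 2 - a₁ ^ 2) * u) (hc : c₂ - c₁ = (a₂ - a₁) * u ^ 2)
    (l₁ : Linked (a₁, b₁, c₁) x (a, b, c)) (l₂ : Linked (a₂, b₂, c₂) y (a, b, c)) :
    x ≠ u ∧ (a ^ 2 - (a₁ + a₂) * a - (a₁ ^ 2 + a₁ * a₂ + a₂ ^ 2)) * x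
      + u * (a ^ 2 + (a₁ + a₂) * a + a₁ ^ 2 + a₁ * a₂ - a₂ ^ 2) = 0 := by
  have hxu : x ≠ u := by
    rintro rfl
    have e1 : b - b₁ = (a ^ 2 - a₁ ^ 2) * x := l₁.2.1
    have e2 : b - b₂ = (a ^ 2 - a₂ ^ 2) * y := l₂.2.1
    refine hxy (mul_left_cancel₀ (hA.sq_sub_sq_ne_zero ha h₂ l₂.1) ?_)
    linear_combination e2 - e1 + hb
  refine ⟨hxu, ?_⟩
  have e := linked_quadratic l₁ l₂
  rw [hb, hc] at e
  refine mul_left_cancel₀ (mul_ne_zero (mul_ne_zero (sub_ne_zero.2 l₁.1) (sub_ne_zero.2 h₁₂.symm))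
    (sub_ne_zero.2 hxu)) ?_
  simp only
  linear_combination e

open Polynomial in
-- Only the coefficients of `X ^ 4` and `X ^ 3` are needed.
theorem coeff_of_quartic_eq_zero {u v s n q s' n' q' : F}
    (h : C u * (X ^ 2 + C s * X + C n) * (X ^ 2 - C s' * X - C q')
      - C v * (X ^ 2 + C s' * X + C n') * (X ^ 2 - C s * X - C q) = 0) :
    u = v ∧ (u + v) * (s - s') = 0 := by
  have e : C (u - v) * X ^ 4 + C ((u + v) * (s - s')) * X ^ 3
      + C (u * (n - q' - s * s') - v * (n' - q - s' * s)) * X ^ 2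
      + C (u * (- s * q' - n * s') - v * (- s' * q - n' * s)) * X
      + C (- u * n * q' + v * n' * q) = 0 := by
    rw [← h]
    simp only [map_add, map_sub, map_mul, map_neg]
    ring
  have h4 := congrArg (coeff · 4) e
  have h3 := congrArg (coeff · 3) e
  simp only [coeff_add, coeff_C_mul, coeff_X_pow, coeff_X, coeff_C, coeff_zero] at h3 h4
  norm_num at h3 h4
  exact ⟨sub_eq_zero.1 h4, mul_eq_zero.2 h3⟩

open Polynomial in
/-- Three pairwise linked points have at most eight triply linked points. -/
theorem card_le_of_closed (hA : SumFree A) {P₁ P₂ P₃ : F × F × F} (h₁ : P₁.1 ∈ A)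
    (h₂ : P₂.1 ∈ A) (h₃ : P₃.1 ∈ A) (h₁₂ : P₁.1 ≠ P₂.1) (h₁₃ : P₁.1 ≠ P₃.1) (h₂₃ : P₂.1 ≠ P₃.1)
    {S : Finset (F × F × F)} (hS : ∀ Q ∈ S, Q.1 ∈ A ∧ TripleLinked P₁ P₂ P₃ Q)
    (hc₂ : P₂.2.2 - P₁.2.2 = (P₂.1 - P₁.1) * slope₂ P₁ P₂ ^ 2)
    (hc₃ : P₃.2.2 - P₁.2.2 = (P₃.1 - P₁.1) * slope₂ P₁ P₃ ^ 2) : S.card ≤ 8 := by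
  have e12 : P₂.2.1 - P₁.2.1 = (P₂.1 ^ 2 - P₁.1 ^ 2) * slope₂ P₁ P₂ := by
    rw [slope₂, mul_div_cancel₀ _ (hA.sq_sub_sq_ne_zero h₂ h₁ h₁₂.symm)]
  have e13 : P₃.2.1 - P₁.2.1 = (P₃.1 ^ 2 - P₁.1 ^ 2) * slope₂ P₁ P₃ := by
    rw [slope₂, mul_div_cancel₀ _ (hA.sq_sub_sq_ne_zero h₃ h₁ h₁₃.symm)]
  generalize slope₂ P₁ P₂ = u at *
  generalize slope₂ P₁ P₃ = v at *
  have conj : ∀ Q ∈ S, ∃ x, x ≠ u ∧ x ≠ v ∧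
      (Q.1 ^ 2 - (P₁.1 + P₂.1) * Q.1 - (P₁.1 ^ 2 + P₁.1 * P₂.1 + P₂.1 ^ 2)) * x
        + u * (Q.1 ^ 2 + (P₁.1 + P₂.1) * Q.1 + P₁.1 ^ 2 + P₁.1 * P₂.1 - P₂.1 ^ 2) = 0 ∧
      (Q.1 ^ 2 - (P₁.1 + P₃.1) * Q.1 - (P₁.1 ^ 2 + P₁.1 * P₃.1 + P₃.1 ^ 2)) * x
        + v * (Q.1 ^ 2 + (P₁.1 + P₃.1) * Q.1 + P₁.1 ^ 2 + P₁.1 * P₃.1 - P₃.1 ^ 2) = 0 := by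
    intro Q hQ
    obtain ⟨ha, x, y, z, hxy, hxz, -, l1, l2, l3⟩ := hS Q hQ
    obtain ⟨p, q⟩ := linked_conjugate hA h₂ ha h₁₂ hxy e12 hc₂ l1 l2
    obtain ⟨p', q'⟩ := linked_conjugate hA h₃ ha h₁₃ hxz e13 hc₃ l1 l3
    exact ⟨x, p, p', q, q'⟩
  -- Eliminating `x` from the two linear equations gives a quartic in `Q.1`, which is identically
  -- zero precisely in this degenerate case. There the difference of the two equations already
  -- forces `x = 0 = u`, so no point survives.
  by_cases h0 : u = 0 ∧ v = 0
  · obtain ⟨rfl, rfl⟩ := h0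
    suffices S = ∅ by simp [this]
    rw [Finset.eq_empty_iff_forall_notMem]
    intro Q hQ
    obtain ⟨x, hx, -, q, q'⟩ := conj Q hQ
    have : (P₃.1 - P₂.1) * (Q.1 + P₁.1 + P₂.1 + P₃.1) * x = 0 := by
      linear_combination q - q'
    exact mul_ne_zero (mul_ne_zero (sub_ne_zero.2 h₂₃.symm)
      (hA.four _ (hS Q hQ).1 _ h₁ _ h₂ _ h₃)) hx this
  · refine card_le_of_poly (k := 2) (d := 4)
      (R := C u * (X ^ 2 + C (P₁.1 + P₂.1) * X + C (P₁.1 ^ 2 + P₁.1 * P₂.1 - P₂.1 ^ 2))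
          * (X ^ 2 - C (P₁.1 + P₃.1) * X - C (P₁.1 ^ 2 + P₁.1 * P₃.1 + P₃.1 ^ 2))
        - C v * (X ^ 2 + C (P₁.1 + P₃.1) * X + C (P₁.1 ^ 2 + P₁.1 * P₃.1 - P₃.1 ^ 2))
          * (X ^ 2 - C (P₁.1 + P₂.1) * X - C (P₁.1 ^ 2 + P₁.1 * P₂.1 + P₂.1 ^ 2)))
      ?_ (by compute_degree) (fun Q hQ => ?_) fun a T hT ha =>
        card_fibre_le_two hA h₁ h₂ h₃ h₁₂ h₁₃ h₂₃ (fun Q hQ => hS Q (hT hQ)) a ha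
    · intro e
      obtain ⟨h, h'⟩ := coeff_of_quartic_eq_zero e
      refine (mul_eq_zero.1 h').elim (fun huv => h0 ?_) fun h'' => h₂₃ (by linear_combination h'')
      have hu : 2 * u = 0 := by linear_combination huv + h
      have := (mul_eq_zero.1 hu).resolve_left (hA.two_ne_zero h₁)
      exact ⟨this, h ▸ this⟩
    · obtain ⟨x, -, -, q, q'⟩ := conj Q hQ
      simp only [eval_sub, eval_add, eval_mul, eval_C, eval_X, eval_pow]
      linear_combination (Q.1 ^ 2 - (P₁.1 + P₃.1) * Q.1 - (P₁.1 ^ 2 + P₁.1 * P₃.1 + P₃.1 ^ 2)) * q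
        - (Q.1 ^ 2 - (P₁.1 + P₂.1) * Q.1 - (P₁.1 ^ 2 + P₁.1 * P₂.1 + P₂.1 ^ 2)) * q'

/-- Two points with the same first coordinate: at most twenty triply linked points. -/
theorem card_le_of_fst_eq (hA : SumFree A) {P₁ P₂ P₃ : F × F × F} (h₁ : P₁.1 ∈ A)
    (h₃ : P₃.1 ∈ A) (h₁₂ : P₁.1 = P₂.1) (n₁₂ : P₁ ≠ P₂) (n₁₃ : P₁ ≠ P₃) (n₂₃ : P₂ ≠ P₃)
    {S : Finset (F × F × F)} (hS : ∀ Q ∈ S, Q.1 ∈ A ∧ TripleLinked P₁ P₂ P₃ Q) : S.card ≤ 20 := by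
  obtain rfl | ⟨Q₀, hQ₀⟩ := S.eq_empty_or_nonempty
  · simp
  have hD : ∀ Q ∈ S, ∀ P : F × F × F, P.1 ∈ A → (∃ x, Linked P x Q) →
      (Q.1 - P.1) * (Q.1 + P.1) ^ 2 ≠ 0 := by
    rintro Q hQ P hP ⟨x, hx⟩
    exact mul_ne_zero (sub_ne_zero.2 hx.1) (pow_ne_zero 2 (hA.two _ (hS Q hQ).1 _ hP))
  have snd_ne : ∀ P P' : F × F × F, P.1 ∈ A → P.1 = P'.1 → P ≠ P' →
      (∃ x y, Linked P x Q₀ ∧ Linked P' y Q₀) → P'.2.1 - P.2.1 ≠ 0 := by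
    rintro P P' hP hPP' hne ⟨x, y, hx, hy⟩ h0
    have e := linked_quadratic hx hy
    rw [h0, ← hPP'] at e
    have : (P'.2.2 - P.2.2) * ((Q₀.1 - P.1) * (Q₀.1 + P.1) ^ 2) = 0 := by linear_combination - e
    refine hne (Prod.ext hPP' (Prod.ext ?_ ?_))
    · linear_combination - h0
    · linear_combination - (mul_eq_zero.1 this).resolve_right (hD Q₀ hQ₀ P hP ⟨x, hx⟩)
  obtain ⟨x₀, y₀, z₀, -, -, -, l₁, l₂, l₃⟩ := (hS Q₀ hQ₀).2
  have b₁₂ := snd_ne P₁ P₂ h₁ h₁₂ n₁₂ ⟨x₀, y₀, l₁, l₂⟩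
  have fibre : ∀ a, ∀ T ⊆ S, (∀ Q ∈ T, Q.1 = a) → T.card ≤ 2 := by
    intro a T hT ha
    obtain rfl | ⟨Q, hQ⟩ := T.eq_empty_or_nonempty
    · simp
    refine card_fibre_le_of_linked (P₁ := P₁) (P₂ := P₂) (a := a) (Or.inr ?_) fun Q hQ => ?_
    · obtain ⟨x, y, z, -, -, -, h1, h2, h3⟩ := (hS Q (hT hQ)).2
      refine mul_ne_zero (mul_ne_zero (hA.two_ne_zero h₁) b₁₂) (ha Q hQ ▸ ?_)
      exact hA.sq_sub_sq_ne_zero (hS Q (hT hQ)).1 h₁ h1.1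
    · obtain ⟨x, y, z, -, -, -, h1, h2, h3⟩ := (hS Q (hT hQ)).2
      exact ⟨ha Q hQ, x, y, h1, h2⟩
  by_cases h₁₃ : P₁.1 = P₃.1
  · have b₁₃ := snd_ne P₁ P₃ h₁ h₁₃ n₁₃ ⟨x₀, z₀, l₁, l₃⟩
    have b₂₃ := snd_ne P₂ P₃ (h₁₂ ▸ h₁) (h₁₂.symm.trans h₁₃) n₂₃ ⟨y₀, z₀, l₂, l₃⟩
    refine (card_le_of_poly (k := 2) (d := 3) (R := .C ((P₃.2.1 - P₁.2.1) * (P₂.2.2 - P₁.2.2)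
      - (P₂.2.1 - P₁.2.1) * (P₃.2.2 - P₁.2.2)) * ((.X - .C P₁.1) * (.X + .C P₁.1) ^ 2)
      - .C ((P₂.2.1 - P₁.2.1) * (P₃.2.1 - P₁.2.1) * (P₃.2.1 - P₂.2.1))) ?_ (by compute_degree)
      (fun Q hQ => ?_) fibre).trans (by norm_num)
    -- At `X = P₁.1` only the constant term remains: a product of the three differences of second
    -- coordinates, each nonzero.
    · intro e
      have := congrArg (Polynomial.eval P₁.1) e
      simp [sub_eq_zero] at this
      simp only [ne_eq, sub_eq_zero] at b₁₂ b₁₃ b₂₃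
      tauto
    · obtain ⟨x, y, z, -, -, -, h1, h2, h3⟩ := (hS Q hQ).2
      have e2 := linked_quadratic h1 h2
      have e3 := linked_quadratic h1 h3
      rw [← h₁₂] at e2
      rw [← h₁₃] at e3
      simp only [Polynomial.eval_add, Polynomial.eval_mul, Polynomial.eval_pow,
        Polynomial.eval_sub, Polynomial.eval_C, Polynomial.eval_X]
      linear_combination (P₂.2.1 - P₁.2.1) * e3 - (P₃.2.1 - P₁.2.1) * e2
  · refine card_le_of_poly (k := 2) (R := resultantPoly P₁ P₂ P₃) ?_ (natDegree_resultantPoly _ _ _)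
      (fun Q hQ => (hS Q hQ).2.eval_resultantPoly) fibre
    intro e
    have ev := congrArg (Polynomial.eval P₁.1) e
    simp only [resultantPoly, Polynomial.eval_add, Polynomial.eval_mul, Polynomial.eval_pow,
      Polynomial.eval_sub, Polynomial.eval_C, Polynomial.eval_X, Polynomial.eval_ofNat,
      Polynomial.eval_zero, ← h₁₂] at ev
    have : ((P₃.1 - P₁.1) * (P₁.1 + P₃.1) ^ 2 * (P₂.2.1 - P₁.2.1) ^ 2) ^ 2 = 0 := by
      linear_combination ev
    have n := sub_ne_zero.2 (Ne.symm h₁₃)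
    have s := hA.two _ h₁ _ h₃
    exact pow_ne_zero 2 (mul_ne_zero (mul_ne_zero n (pow_ne_zero 2 s)) (pow_ne_zero 2 b₁₂)) this

/-- Three distinct points have at most twenty-four triply linked points. -/
theorem card_tripleLinked_le (hA : SumFree A) {P₁ P₂ P₃ : F × F × F} (h₁ : P₁.1 ∈ A)
    (h₂ : P₂.1 ∈ A) (h₃ : P₃.1 ∈ A) (n₁₂ : P₁ ≠ P₂) (n₁₃ : P₁ ≠ P₃) (n₂₃ : P₂ ≠ P₃)
    {S : Finset (F × F × F)} (hS : ∀ Q ∈ S, Q.1 ∈ A ∧ TripleLinked P₁ P₂ P₃ Q) : S.card ≤ 24 := by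
  by_cases h₁₂ : P₁.1 = P₂.1
  · exact (card_le_of_fst_eq hA h₁ h₃ h₁₂ n₁₂ n₁₃ n₂₃ hS).trans (by norm_num)
  by_cases h₁₃ : P₁.1 = P₃.1
  · exact (card_le_of_fst_eq hA h₁ h₂ h₁₃ n₁₃ n₁₂ n₂₃.symm
      fun Q hQ => ⟨(hS Q hQ).1, (hS Q hQ).2.swap₂₃⟩).trans (by norm_num)
  by_cases h₂₃ : P₂.1 = P₃.1
  · exact (card_le_of_fst_eq hA h₂ h₁ h₂₃ n₂₃ n₁₂.symm n₁₃.symm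
      fun Q hQ => ⟨(hS Q hQ).1, (hS Q hQ).2.rotate⟩).trans (by norm_num)
  by_contra! hlt
  have c₁ : P₃.2.2 - P₁.2.2 =
      (P₂.1 - P₁.1) * slope₂ P₁ P₂ ^ 2 + (P₃.1 - P₂.1) * slope₂ P₂ P₃ ^ 2 := by
    by_contra h
    have := card_le_of_not_closed hA h₁ h₂ h₃ h₁₂ h₁₃ h₂₃ hS h
    omega
  have c₂ : P₁.2.2 - P₂.2.2 =
      (P₃.1 - P₂.1) * slope₂ P₂ P₃ ^ 2 + (P₁.1 - P₃.1) * slope₂ P₃ P₁ ^ 2 := by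
    by_contra h
    have := card_le_of_not_closed hA h₂ h₃ h₁ h₂₃ (Ne.symm h₁₂) (Ne.symm h₁₃)
      (fun Q hQ => ⟨(hS Q hQ).1, (hS Q hQ).2.rotate⟩) h
    omega
  have c₃ : P₂.2.2 - P₃.2.2 =
      (P₁.1 - P₃.1) * slope₂ P₃ P₁ ^ 2 + (P₂.1 - P₁.1) * slope₂ P₁ P₂ ^ 2 := by
    by_contra h
    have := card_le_of_not_closed hA h₃ h₁ h₂ (Ne.symm h₁₃) (Ne.symm h₂₃) h₁₂
      (fun Q hQ => ⟨(hS Q hQ).1, (hS Q hQ).2.rotate.rotate⟩) h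
    omega
  -- Adding the three closing conditions shows that twice the sum of the three edge terms is zero.
  -- As 2 is invertible, each difference of third coordinates then equals its own edge term, so the
  -- points are pairwise linked.
  rw [slope₂_comm P₃ P₁] at c₂ c₃
  have t := hA.two_ne_zero h₁
  have := card_le_of_closed hA h₁ h₂ h₃ h₁₂ h₁₃ h₂₃ hS
    (mul_left_cancel₀ t (by linear_combination c₁ - c₂ + c₃))
    (mul_left_cancel₀ t (by linear_combination c₁ - c₂ - c₃))
  omega

end TripleLinked

/-! ### Subdivided bicliques as explicit configurations. -/

/-- A copy of the `1`-subdivision of `K_{s,t}`, given by its branch vertices and its subdividing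
vertices. -/
structure SubdividedBiclique {V : Type*} (G : SimpleGraph V) (s t : ℕ) where
  left : Fin s → V
  right : Fin t → V
  mid : Fin s → Fin t → V
  left_inj : Function.Injective left
  right_inj : Function.Injective right
  mid_inj : ∀ i j i' j', mid i j = mid i' j' → i = i' ∧ j = j'
  left_ne_right : ∀ i j, left i ≠ right j
  left_ne_mid : ∀ k i j, left k ≠ mid i j
  right_ne_mid : ∀ k i j, right k ≠ mid i j
  adj_left : ∀ i j, G.Adj (left i) (mid i j)
  adj_right : ∀ i j, G.Adj (right j) (mid i j)

section SubdividedBiclique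

variable {V : Type*} {G : SimpleGraph V} {s t : ℕ}

theorem SubdividedBiclique.isContained (B : SubdividedBiclique G s t) :
    (oneSubdivision (completeBipartiteGraph (Fin s) (Fin t))).IsContained G := by
  have key : ∀ e : (completeBipartiteGraph (Fin s) (Fin t)).edgeSet,
      ∃ i j, (e : Sym2 (Fin s ⊕ Fin t)) = s(Sum.inl i, Sum.inr j) := by
    rintro ⟨e, he⟩
    induction e with
    | _ u v =>
      rcases u with i | j <;> rcases v with i' | j' <;> simp at he
      · exact ⟨i, j', rfl⟩
      · exact ⟨i', j, Sym2.eq_swap⟩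
  choose l r hlr using key
  let f : (Fin s ⊕ Fin t) ⊕ (completeBipartiteGraph (Fin s) (Fin t)).edgeSet → V :=
    Sum.elim (Sum.elim B.left B.right) fun e => B.mid (l e) (r e)
  refine ⟨⟨⟨f, ?_⟩, ?_⟩⟩
  · have main : ∀ (v : Fin s ⊕ Fin t) (e : (completeBipartiteGraph (Fin s) (Fin t)).edgeSet),
        v ∈ (e : Sym2 (Fin s ⊕ Fin t)) →
        G.Adj (f (Sum.inl v)) (f (Sum.inr e)) := by
      intro v e hv
      rw [hlr e, Sym2.mem_iff] at hv
      rcases hv with rfl | rfl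
      · exact B.adj_left _ _
      · exact B.adj_right _ _
    rintro (v | e) (w | e') h
    · exact h.elim
    · exact main v e' h
    · exact (main w e h).symm
    · exact h.elim
  · rintro ((i | j) | e) ((i' | j') | e') h <;>
      simp only [f, RelHom.coeFn_mk, Sum.elim_inl, Sum.elim_inr] at h
    · rw [B.left_inj h]
    · exact (B.left_ne_right _ _ h).elim
    · exact (B.left_ne_mid _ _ _ h).elim
    · exact (B.left_ne_right _ _ h.symm).elim
    · rw [B.right_inj h]
    · exact (B.right_ne_mid _ _ _ h).elim
    · exact (B.left_ne_mid _ _ _ h.symm).elim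
    · exact (B.right_ne_mid _ _ _ h.symm).elim
    · obtain ⟨h1, h2⟩ := B.mid_inj _ _ _ _ h
      congr 1
      apply Subtype.ext
      rw [hlr e, hlr e', h1, h2]

theorem nonempty_subdividedBiclique
    (h : (oneSubdivision (completeBipartiteGraph (Fin s) (Fin t))).IsContained G) :
    Nonempty (SubdividedBiclique G s t) := by
  obtain ⟨f⟩ := h
  have hE (i : Fin s) (j : Fin t) :
      s(Sum.inl i, Sum.inr j) ∈ (completeBipartiteGraph (Fin s) (Fin t)).edgeSet := by simp
  refine ⟨⟨fun i => f (Sum.inl (Sum.inl i)), fun j => f (Sum.inl (Sum.inr j)),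
    fun i j => f (Sum.inr ⟨_, hE i j⟩), ?_, ?_, ?_, ?_, ?_, ?_, ?_, ?_⟩⟩
  · intro i j h
    simpa using f.injective h
  · intro i j h
    simpa using f.injective h
  · intro i j i' j' h
    simpa using f.injective h
  · intro i j h
    simpa using f.injective h
  · intro k i j h
    simpa using f.injective h
  · intro k i j h
    simpa using f.injective h
  · exact fun i j => f.toHom.map_adj (show Sum.inl i ∈ s(Sum.inl i, Sum.inr j) by simp)
  · exact fun i j => f.toHom.map_adj (show Sum.inr j ∈ s(Sum.inl i, Sum.inr j) by simp)

/-- A subdivided biclique without isolated vertices lifts along an injective map of graphs. -/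
theorem nonempty_subdividedBiclique_of_map {W : Type*} (e : V ↪ W) (hs : 0 < s) (ht : 0 < t)
    (B : SubdividedBiclique (G.map e) s t) : Nonempty (SubdividedBiclique G s t) := by
  have lift : ∀ {u v}, (G.map e).Adj u v → ∃ u' v', e u' = u ∧ e v' = v := by
    intro u v h
    obtain ⟨u', v', -, hu, hv⟩ := (SimpleGraph.map_adj e G u v).1 h
    exact ⟨u', v', hu, hv⟩
  have hl (i) : ∃ v, e v = B.left i := (lift (B.adj_left i ⟨0, ht⟩)).imp fun _ ⟨_, h⟩ => h.1
  have hr (j) : ∃ v, e v = B.right j := (lift (B.adj_right ⟨0, hs⟩ j)).imp fun _ ⟨_, h⟩ => h.1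
  have hm (i j) : ∃ v, e v = B.mid i j := by
    obtain ⟨_, v, -, h⟩ := lift (B.adj_left i j)
    exact ⟨v, h⟩
  choose l hl using hl
  choose r hr using hr
  choose m hm using hm
  refine ⟨⟨l, r, m, ?_, ?_, ?_, ?_, ?_, ?_, ?_, ?_⟩⟩
  · intro i j h
    exact B.left_inj (by rw [← hl, ← hl, h])
  · intro i j h
    exact B.right_inj (by rw [← hr, ← hr, h])
  · intro i j i' j' h
    exact B.mid_inj _ _ _ _ (by rw [← hm, ← hm, h])
  · intro i j h
    exact B.left_ne_right i j (by rw [← hl, ← hr, h])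
  · intro k i j h
    exact B.left_ne_mid k i j (by rw [← hl, ← hm, h])
  · intro k i j h
    exact B.right_ne_mid k i j (by rw [← hr, ← hm, h])
  · intro i j
    rw [← SimpleGraph.map_adj_apply (f := e), hl, hm]
    exact B.adj_left i j
  · intro i j
    rw [← SimpleGraph.map_adj_apply (f := e), hr, hm]
    exact B.adj_right i j

/-- Padding with isolated vertices reaches exactly `n` vertices and creates no copy, because every
vertex of the forbidden graph has a neighbour. -/
theorem card_edgeFinset_le_extremalNumber_of_card_le [Fintype V] [DecidableRel G.Adj] {n : ℕ}
    (hn : Fintype.card V ≤ n) (hs : 0 < s) (ht : 0 < t) (hG : IsEmpty (SubdividedBiclique G s t)) :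
    G.edgeFinset.card ≤
      SimpleGraph.extremalNumber n (oneSubdivision (completeBipartiteGraph (Fin s) (Fin t))) := by
  classical
  obtain ⟨e⟩ := Function.Embedding.nonempty_of_card_le (α := V) (β := Fin n) (by simpa using hn)
  have hfree : (oneSubdivision (completeBipartiteGraph (Fin s) (Fin t))).Free (G.map e) := by
    intro h
    obtain ⟨B⟩ := nonempty_subdividedBiclique h
    exact not_nonempty_iff.2 hG (nonempty_subdividedBiclique_of_map e hs ht B)
  have h := SimpleGraph.card_edgeFinset_le_extremalNumber hfree
  rw [Fintype.card_fin] at h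
  refine le_trans (le_of_eq ?_) h
  rw [← SimpleGraph.card_edgeFinset_map e G]

end SubdividedBiclique

/-! ### Lower bound: the algebraic graph over `ZMod p`. -/

section LinkGraph

variable {F : Type*} [Field F]

/-- The graph on `F³` in which `(a, b, c)` and `(x, y, z)`, with `a, x ∈ A`, are adjacent when
`b + z = a² x` and `c + y = a x²`. -/
def linkGraph (A : Set F) : SimpleGraph (F × F × F) where
  Adj P Q := P ≠ Q ∧ P.1 ∈ A ∧ Q.1 ∈ A ∧ P.2.1 + Q.2.2 = P.1 ^ 2 * Q.1 ∧
    P.2.2 + Q.2.1 = Q.1 ^ 2 * P.1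
  symm := ⟨fun P Q ⟨h, hP, hQ, h1, h2⟩ =>
    ⟨h.symm, hQ, hP, by rw [← h2, add_comm], by rw [← h1, add_comm]⟩⟩
  loopless := ⟨fun P h => h.1 rfl⟩

theorem linked_of_adj {A : Set F} {P Q W : F × F × F} (hPQ : P ≠ Q) (hP : (linkGraph A).Adj P W)
    (hQ : (linkGraph A).Adj Q W) : Linked P W.1 Q := by
  obtain ⟨-, -, -, h1, h2⟩ := hP
  obtain ⟨-, -, -, h3, h4⟩ := hQ
  have e1 : Q.2.1 - P.2.1 = (Q.1 ^ 2 - P.1 ^ 2) * W.1 := by linear_combination h3 - h1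
  have e2 : Q.2.2 - P.2.2 = (Q.1 - P.1) * W.1 ^ 2 := by linear_combination h4 - h2
  refine ⟨fun h => hPQ ?_, e1, e2⟩
  rw [h, sub_self, zero_mul, sub_eq_zero] at e1 e2
  exact Prod.ext h.symm (Prod.ext e1.symm e2.symm)

/-- This gives the distinctness demanded by `TripleLinked`: different subdividing vertices next to
one right vertex have different first coordinates. -/
theorem eq_of_adj_of_fst_eq {A : Set F} {Q W W' : F × F × F} (h : (linkGraph A).Adj Q W)
    (h' : (linkGraph A).Adj Q W') (e : W.1 = W'.1) : W = W' := by
  obtain ⟨-, -, -, h1, h2⟩ := h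
  obtain ⟨-, -, -, h3, h4⟩ := h'
  rw [← e] at h3 h4
  exact Prod.ext e (Prod.ext (by linear_combination h2 - h4) (by linear_combination h1 - h3))

theorem linkGraph_isEmpty {A : Set F} (hA : SumFree A) :
    IsEmpty (SubdividedBiclique (linkGraph A) 3 25) := by
  classical
  refine ⟨fun B => ?_⟩
  have hl (i) : (B.left i).1 ∈ A := (B.adj_left i 0).2.1
  have hne {i j} (h : i ≠ j) : B.left i ≠ B.left j := fun e => h (B.left_inj e)
  have := card_tripleLinked_le hA (hl 0) (hl 1) (hl 2) (hne (by decide)) (hne (by decide))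
    (hne (by decide)) (S := Finset.univ.image B.right) (by
      simp only [Finset.mem_image, Finset.mem_univ, true_and, forall_exists_index,
        forall_apply_eq_imp_iff]
      intro j
      have hd {i i'} (h : i ≠ i') : (B.mid i j).1 ≠ (B.mid i' j).1 := fun e =>
        h (B.mid_inj _ _ _ _ (eq_of_adj_of_fst_eq (B.adj_right i j) (B.adj_right i' j) e)).1
      have hL i := linked_of_adj (B.left_ne_right i j) (B.adj_left i j) (B.adj_right i j)
      exact ⟨(B.adj_right 0 j).2.1, _, _, _, hd (by decide), hd (by decide), hd (by decide),
        hL 0, hL 1, hL 2⟩)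
  rw [Finset.card_image_of_injective _ B.right_inj] at this
  simp at this

theorem le_degree_linkGraph [Fintype F] [DecidableEq F] (A : Finset F)
    [DecidableRel (linkGraph (A : Set F)).Adj] {P : F × F × F} (hP : P.1 ∈ A) :
    A.card - 1 ≤ (linkGraph (A : Set F)).degree P := by
  let g : F → F × F × F := fun x => (x, x ^ 2 * P.1 - P.2.2, P.1 ^ 2 * x - P.2.1)
  have hg : Function.Injective g := fun x y h => congrArg Prod.fst h
  rw [← Finset.card_image_of_injective A hg]
  -- The lost unit accounts for `P` possibly solving its own equations, since loops are excluded.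
  refine (Finset.pred_card_le_card_erase (a := P)).trans (Finset.card_le_card fun W hW => ?_)
  simp only [Finset.mem_erase, Finset.mem_image] at hW
  obtain ⟨hne, x, hx, rfl⟩ := hW
  rw [SimpleGraph.mem_neighborFinset]
  exact ⟨hne.symm, hP, hx, by simp [g], by simp [g]⟩

theorem le_card_edgeFinset_linkGraph [Fintype F] [DecidableEq F] (A : Finset F)
    [DecidableRel (linkGraph (A : Set F)).Adj] :
    A.card * Fintype.card F ^ 2 * (A.card - 1) ≤ 2 * (linkGraph (A : Set F)).edgeFinset.card := by
  rw [← SimpleGraph.sum_degrees_eq_twice_card_edges]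
  calc A.card * Fintype.card F ^ 2 * (A.card - 1)
      = ∑ P ∈ A ×ˢ (Finset.univ : Finset (F × F)), (A.card - 1) := by
        simp [Finset.card_product, sq]
    _ ≤ ∑ P ∈ A ×ˢ (Finset.univ : Finset (F × F)), (linkGraph (A : Set F)).degree P :=
        Finset.sum_le_sum fun P hP => le_degree_linkGraph A (Finset.mem_product.1 hP).1
    _ ≤ _ := Finset.sum_le_sum_of_subset (Finset.subset_univ _)

/-- Four representatives in `[1, (p - 1) / 4]` have sum strictly between 0 and `p`, so there is no
wraparound. -/
theorem sumFree_interval (p : ℕ) [Fact p.Prime] :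
    SumFree (((Finset.Icc 1 ((p - 1) / 4)).image (Nat.cast : ℕ → ZMod p) : Finset (ZMod p)) :
      Set (ZMod p)) := by
  have hp := (Fact.out : p.Prime).two_le
  have key : ∀ k : ℕ, 0 < k → k < p → (k : ZMod p) ≠ 0 := by
    intro k hk hkp h
    exact absurd (Nat.le_of_dvd hk ((ZMod.natCast_eq_zero_iff k p).1 h)) (by omega)
  constructor
  · intro a ha b hb
    simp only [Finset.coe_image, Set.mem_image, Finset.mem_coe, Finset.mem_Icc] at ha hb
    obtain ⟨a, ha, rfl⟩ := ha
    obtain ⟨b, hb, rfl⟩ := hb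
    exact_mod_cast key (a + b) (by omega) (by omega)
  · intro a ha b hb c hc d hd
    simp only [Finset.coe_image, Set.mem_image, Finset.mem_coe, Finset.mem_Icc] at ha hb hc hd
    obtain ⟨a, ha, rfl⟩ := ha
    obtain ⟨b, hb, rfl⟩ := hb
    obtain ⟨c, hc, rfl⟩ := hc
    obtain ⟨d, hd, rfl⟩ := hd
    exact_mod_cast key (a + b + c + d) (by omega) (by omega)

theorem card_interval (p : ℕ) [Fact p.Prime] :
    ((Finset.Icc 1 ((p - 1) / 4)).image (Nat.cast : ℕ → ZMod p)).card = (p - 1) / 4 := by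
  rw [Finset.card_image_of_injOn, Nat.card_Icc, Nat.add_sub_cancel]
  intro a ha b hb h
  simp only [Finset.coe_Icc, Set.mem_Icc] at ha hb
  have := (ZMod.natCast_eq_natCast_iff' a b p).1 h
  rwa [Nat.mod_eq_of_lt (by omega), Nat.mod_eq_of_lt (by omega)] at this

theorem extremalNumber_ge_of_prime {p n : ℕ} (hp : p.Prime) (hpn : p ^ 3 ≤ n) (h16 : 16 ≤ p) :
    p ^ 4 ≤ 128 * SimpleGraph.extremalNumber n
      (oneSubdivision (completeBipartiteGraph (Fin 3) (Fin 25))) := by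
  classical
  have := Fact.mk hp
  set A := (Finset.Icc 1 ((p - 1) / 4)).image (Nat.cast : ℕ → ZMod p) with hA
  have h1 := card_edgeFinset_le_extremalNumber_of_card_le (n := n) (G := linkGraph (A : Set (ZMod p)))
    (s := 3) (t := 25) (by
      rw [Fintype.card_prod, Fintype.card_prod, ZMod.card]
      exact le_trans (le_of_eq (by ring)) hpn) (by norm_num) (by norm_num)
      (linkGraph_isEmpty (sumFree_interval p))
  have h2 := le_card_edgeFinset_linkGraph A
  rw [hA, card_interval, ← hA, ZMod.card] at h2
  have h3 : p ≤ 8 * ((p - 1) / 4 - 1) := by omega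
  have h4 : p ≤ 8 * ((p - 1) / 4) := by omega
  calc p ^ 4 = p * p ^ 2 * p := by ring
    _ ≤ (8 * ((p - 1) / 4)) * p ^ 2 * (8 * ((p - 1) / 4 - 1)) := by gcongr
    _ = 64 * ((p - 1) / 4 * p ^ 2 * ((p - 1) / 4 - 1)) := by ring
    _ ≤ 64 * (2 * (linkGraph (A : Set (ZMod p))).edgeFinset.card) := by gcongr
    _ ≤ _ := by omega

theorem extremalNumber_lower_bound {n : ℕ} (hn : 32 ^ 3 ≤ n) :
    (n : ℝ) ^ ((4 : ℝ) / 3) ≤ 2048 * SimpleGraph.extremalNumber n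
      (oneSubdivision (completeBipartiteGraph (Fin 3) (Fin 25))) := by
  set r : ℝ := (n : ℝ) ^ ((1 : ℝ) / 3) with hr
  have hr3 : r ^ 3 = n := by
    rw [hr, ← Real.rpow_natCast, ← Real.rpow_mul (by positivity)]
    norm_num
  have hr4 : (n : ℝ) ^ ((4 : ℝ) / 3) = r ^ 4 := by
    rw [hr, ← Real.rpow_natCast, ← Real.rpow_mul (by positivity)]
    norm_num
  have hr0 : 0 ≤ r := by positivity
  have h32 : 32 ≤ r := by
    refine le_of_pow_le_pow_left₀ (n := 3) (by norm_num) hr0 ?_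
    rw [hr3]
    exact_mod_cast hn
  have hk : ⌊r / 2⌋₊ ≠ 0 := (Nat.floor_pos.2 (by linarith)).ne'
  -- Bertrand's postulate at `⌊r / 2⌋₊` puts `p` between `r / 2` and `r`. The loss of `2 ^ 4` in `p
  -- ^ 4` turns the constant 128 into 2048.
  obtain ⟨p, hp, hkp, hpk⟩ := Nat.exists_prime_lt_and_le_two_mul _ hk
  have h1 : r / 2 ≤ p := by
    have := Nat.lt_floor_add_one (r / 2)
    have : ((⌊r / 2⌋₊ + 1 : ℕ) : ℝ) ≤ p := by exact_mod_cast hkp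
    push_cast at this
    linarith
  have h2 : (p : ℝ) ≤ r := by
    have := Nat.floor_le (show 0 ≤ r / 2 by linarith)
    have : (p : ℝ) ≤ ((2 * ⌊r / 2⌋₊ : ℕ) : ℝ) := by exact_mod_cast hpk
    push_cast at this
    linarith
  have h3 : p ^ 3 ≤ n := by
    have : (p : ℝ) ^ 3 ≤ n := by rw [← hr3]; gcongr
    exact_mod_cast this
  have h4 : 16 ≤ p := by
    have : (16 : ℝ) ≤ p := by linarith
    exact_mod_cast this
  have h5 : (p : ℝ) ^ 4 ≤ 128 * SimpleGraph.extremalNumber n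
      (oneSubdivision (completeBipartiteGraph (Fin 3) (Fin 25))) := by
    exact_mod_cast extremalNumber_ge_of_prime hp h3 h4
  have h6 : (r / 2) ^ 4 ≤ (p : ℝ) ^ 4 := by gcongr
  rw [hr4]
  linarith [show r ^ 4 = 16 * (r / 2) ^ 4 by ring]

end LinkGraph

/-! ### Selecting distinct vertices and disjoint blocks. -/

/-- Hall's condition is immediate: outside `Z`, each single set is already as large as the whole
index type. -/
theorem exists_injective_choice {ι V : Type*} [Fintype ι] [DecidableEq V] (S : ι → Finset V)
    (Z : Finset V) (h : ∀ i, Fintype.card ι + Z.card ≤ (S i).card) :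
    ∃ f : ι → V, Function.Injective f ∧ ∀ i, f i ∈ S i ∧ f i ∉ Z := by
  obtain ⟨f, hf, hS⟩ := (Finset.all_card_le_biUnion_card_iff_exists_injective
    fun i => S i \ Z).1 fun s => by
      obtain rfl | ⟨i, hi⟩ := s.eq_empty_or_nonempty
      · simp
      · have h1 := Finset.card_le_card (Finset.subset_biUnion_of_mem (fun i => S i \ Z) hi)
        have h2 := Finset.le_card_sdiff Z (S i)
        have h3 := s.card_le_univ
        have h4 := h i
        omega
  exact ⟨f, hf, fun i => Finset.mem_sdiff.1 (hS i)⟩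

/-- Choosing blocks with pairwise disjoint supports from families in which every vertex meets few
blocks. -/
theorem exists_disjoint_blocks {β V : Type*} [DecidableEq V] (supp : β → Finset V) (m D : ℕ)
    (hm : ∀ f, (supp f).card ≤ m) :
    ∀ (r : ℕ) (O : Fin r → Finset β) (Z : Finset V),
      (∀ k z, ((O k).filter fun f => z ∈ supp f).card ≤ D) →
      (∀ k, D * (Z.card + r * m) < (O k).card) →
      ∃ g : Fin r → β, (∀ k, g k ∈ O k) ∧ (∀ k, Disjoint (supp (g k)) Z) ∧
        ∀ k l, k ≠ l → Disjoint (supp (g k)) (supp (g l)) := by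
  intro r
  induction r with
  | zero => exact fun O Z _ _ => ⟨Fin.elim0, fun k => k.elim0, fun k => k.elim0, fun k => k.elim0⟩
  | succ r ih =>
    intro O Z hD hO
    -- Greedy choice: `Z` spoils at most `D * Z.card` blocks, and each chosen block then adds at
    -- most `m` vertices to `Z`.
    have h0 : ∃ f ∈ O 0, Disjoint (supp f) Z := by
      by_contra! h
      have : (O 0).card ≤ Z.card * D := by
        classical
        refine (Finset.card_le_card fun f hf => ?_).trans
          (Finset.card_biUnion_le_card_mul Z (fun z => (O 0).filter fun f => z ∈ supp f) D
            fun z _ => hD 0 z)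
        obtain ⟨z, hz, hz'⟩ := Finset.not_disjoint_iff.1 (h f hf)
        exact Finset.mem_biUnion.2 ⟨z, hz', Finset.mem_filter.2 ⟨hf, hz⟩⟩
      have h2 := hO 0
      rw [mul_add, mul_comm D] at h2
      omega
    obtain ⟨f₀, hf₀, hZ₀⟩ := h0
    obtain ⟨g, hg, hgZ, hgd⟩ := ih (fun k => O k.succ) (Z ∪ supp f₀) (fun k z => hD k.succ z)
      fun k => lt_of_le_of_lt (Nat.mul_le_mul_left D (by
        have := Finset.card_union_le Z (supp f₀)
        have := hm f₀
        linarith [add_mul r 1 m])) (hO k.succ)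
    have hg₀ (k) : Disjoint (supp (g k)) (supp f₀) := (Finset.disjoint_union_right.1 (hgZ k)).2
    refine ⟨Fin.cons f₀ g, fun k => ?_, fun k => ?_, fun k l => ?_⟩
    · refine Fin.cases ?_ (fun k => ?_) k
      · simpa using hf₀
      · simpa using hg k
    · refine Fin.cases ?_ (fun k => ?_) k
      · simpa using hZ₀
      · simpa using (Finset.disjoint_union_right.1 (hgZ k)).1
    · refine Fin.cases ?_ (fun k => ?_) k <;> refine Fin.cases ?_ (fun l => ?_) l
      · simp
      · simpa using fun _ => (hg₀ l).symm
      · simpa using hg₀ k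
      · simpa using fun h => hgd k l h

/-! ### Heavy pairs are rare. -/

section Heavy

variable {V : Type*} [Fintype V] [DecidableEq V] (G : SimpleGraph V) [DecidableRel G.Adj]

/-- The number of common neighbours of two vertices. -/
def codegree (u v : V) : ℕ := (G.neighborFinset u ∩ G.neighborFinset v).card

theorem codegree_comm (u v : V) : codegree G u v = codegree G v u := by
  rw [codegree, codegree, Finset.inter_comm]

/-- Two distinct vertices with at least two hundred common neighbours. -/
def Heavy (u v : V) : Prop := u ≠ v ∧ 200 ≤ codegree G u v

instance : DecidableRel (Heavy G) := fun u v => inferInstanceAs (Decidable (u ≠ v ∧ _))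

variable {G}

theorem card_common_lt {u v : V} (h : codegree G u v < 200) {T : Finset V}
    (hT : ∀ w ∈ T, G.Adj u w ∧ G.Adj v w) : T.card ≤ 200 :=
  (Finset.card_le_card fun w hw => Finset.mem_inter.2
    ⟨(G.mem_neighborFinset u w).2 (hT w hw).1, (G.mem_neighborFinset v w).2 (hT w hw).2⟩).trans h.le

/-- A `K_{3,25}` of heavy pairs could be subdivided inside `G`: its 75 edges need distinct common
neighbours avoiding 28 branch vertices, and `75 + 28 ≤ 200`. -/
theorem card_common_heavy_le (hG : IsEmpty (SubdividedBiclique G 3 25)) (S : Finset V) {x₁ x₂ x₃ : V}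
    (h₁₂ : x₁ ≠ x₂) (h₁₃ : x₁ ≠ x₃) (h₂₃ : x₂ ≠ x₃) :
    (S.filter fun y => Heavy G y x₁ ∧ Heavy G y x₂ ∧ Heavy G y x₃).card ≤ 24 := by
  by_contra! hlt
  obtain ⟨T, hTS, hT⟩ := Finset.exists_subset_card_eq (Nat.succ_le_of_lt hlt)
  have hT' : T.card = 25 := hT
  let l : Fin 3 → V := ![x₁, x₂, x₃]
  have hl : Function.Injective l := by
    intro i j
    fin_cases i <;> fin_cases j <;> simp [l, h₁₂, h₁₃, h₂₃, h₁₂.symm, h₁₃.symm, h₂₃.symm]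
  let r : Fin 25 → V := fun k => (T.equivFinOfCardEq hT').symm k
  have hr : Function.Injective r := fun k k' h =>
    (T.equivFinOfCardEq hT').symm.injective (Subtype.ext h)
  have hH (i : Fin 3) (k : Fin 25) : Heavy G (r k) (l i) := by
    have := (Finset.mem_filter.1 (hTS ((T.equivFinOfCardEq hT').symm k).2)).2
    fin_cases i
    · exact this.1
    · exact this.2.1
    · exact this.2.2
  obtain ⟨m, hm, hmS⟩ := exists_injective_choice (ι := Fin 3 × Fin 25)
    (fun p => G.neighborFinset (r p.2) ∩ G.neighborFinset (l p.1))
    (Finset.univ.image l ∪ Finset.univ.image r) fun p => by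
      have h1 := (hH p.1 p.2).2
      have h2 := Finset.card_union_le (Finset.univ.image l) (Finset.univ.image r)
      have h3 : (Finset.univ.image l).card ≤ (Finset.univ : Finset (Fin 3)).card :=
        Finset.card_image_le
      have h4 : (Finset.univ.image r).card ≤ (Finset.univ : Finset (Fin 25)).card :=
        Finset.card_image_le
      rw [Finset.card_fin] at h3 h4
      have h5 : Fintype.card (Fin 3 × Fin 25) = 75 := by simp
      have h6 : codegree G (r p.2) (l p.1) =
        (G.neighborFinset (r p.2) ∩ G.neighborFinset (l p.1)).card := rfl
      omega
  simp only [Finset.mem_inter, SimpleGraph.mem_neighborFinset, Finset.mem_union, Finset.mem_image,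
    Finset.mem_univ, true_and, not_or, not_exists] at hmS
  exact hG.false ⟨l, r, fun i k => m (i, k), hl, hr, fun i j i' j' h => by simpa using hm h,
    fun i k h => (hH i k).1 h.symm, fun k i j => (hmS (i, j)).2.1 k, fun k i j => (hmS (i, j)).2.2 k,
    fun i j => (hmS (i, j)).1.2, fun i j => (hmS (i, j)).1.1⟩

/-- The cubes count heavy stars with three ordered ends. Distinct ends have at most 24 centres, and
each of the three possible coincidences contributes at most `S.card ^ 3`, so `27 = 24 + 3`. -/
theorem sum_card_heavy_pow_le (hG : IsEmpty (SubdividedBiclique G 3 25)) (S : Finset V) :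
    ∑ y ∈ S, (S.filter fun x => Heavy G y x).card ^ 3 ≤ 27 * S.card ^ 3 := by
  have h1 : ∀ y, (S.filter fun x => Heavy G y x).card ^ 3 =
      ∑ x₁ ∈ S, ∑ x₂ ∈ S, ∑ x₃ ∈ S, if Heavy G y x₁ ∧ Heavy G y x₂ ∧ Heavy G y x₃ then 1 else 0 := by
    intro y
    rw [pow_succ, sq, Finset.card_filter, Finset.sum_mul_sum, Finset.sum_mul]
    refine Finset.sum_congr rfl fun x₁ _ => ?_
    rw [Finset.sum_mul_sum]
    refine Finset.sum_congr rfl fun x₂ _ => Finset.sum_congr rfl fun x₃ _ => ?_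
    split_ifs <;> simp_all
  calc ∑ y ∈ S, (S.filter fun x => Heavy G y x).card ^ 3
      = ∑ x₁ ∈ S, ∑ x₂ ∈ S, ∑ x₃ ∈ S,
          (S.filter fun y => Heavy G y x₁ ∧ Heavy G y x₂ ∧ Heavy G y x₃).card := by
        simp_rw [h1, Finset.card_filter]
        rw [Finset.sum_comm]
        refine Finset.sum_congr rfl fun x₁ _ => ?_
        rw [Finset.sum_comm]
        refine Finset.sum_congr rfl fun x₂ _ => ?_
        rw [Finset.sum_comm]
    _ ≤ ∑ x₁ ∈ S, ∑ x₂ ∈ S, ∑ x₃ ∈ S, (24 + (if x₁ = x₂ then S.card else 0)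
          + (if x₁ = x₃ then S.card else 0) + (if x₂ = x₃ then S.card else 0)) := by
        refine Finset.sum_le_sum fun x₁ _ => Finset.sum_le_sum fun x₂ _ => Finset.sum_le_sum
          fun x₃ _ => ?_
        have := Finset.card_filter_le S fun y => Heavy G y x₁ ∧ Heavy G y x₂ ∧ Heavy G y x₃
        by_cases h₁₂ : x₁ = x₂
        · simp only [h₁₂, if_true] at this ⊢; omega
        by_cases h₁₃ : x₁ = x₃
        · simp only [h₁₃, if_true] at this ⊢; omega
        by_cases h₂₃ : x₂ = x₃
        · simp only [h₂₃, if_true] at this ⊢; omega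
        simpa [h₁₂, h₁₃, h₂₃] using card_common_heavy_le hG S h₁₂ h₁₃ h₂₃
    _ = 27 * S.card ^ 3 := by
        simp only [Finset.sum_add_distrib, Finset.sum_const, smul_eq_mul, Finset.sum_ite_eq]
        have (s : Finset V) (f : V → ℕ) : ∑ x ∈ s, (if x ∈ s then f x else 0) = ∑ x ∈ s, f x :=
          Finset.sum_congr rfl fun x hx => if_pos hx
        simp only [Finset.sum_const, smul_eq_mul, this,
          ← Finset.mul_sum, Finset.sum_ite_eq]
        ring

/-- There are few heavy pairs in a set of vertices. -/
theorem card_heavy_pairs_pow_le (hG : IsEmpty (SubdividedBiclique G 3 25)) (S : Finset V) :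
    ((S ×ˢ S).filter fun p => Heavy G p.1 p.2).card ^ 3 ≤ 27 * S.card ^ 5 := by
  have h1 : ((S ×ˢ S).filter fun p => Heavy G p.1 p.2).card =
      ∑ y ∈ S, (S.filter fun x => Heavy G y x).card := by
    simp_rw [Finset.card_filter]
    rw [Finset.sum_product]
  have h2 := pow_sum_le_card_mul_sum_pow (s := S) (f := fun y => (S.filter fun x => Heavy G y x).card)
    (fun _ _ => Nat.zero_le _) 2
  calc _ = (∑ y ∈ S, (S.filter fun x => Heavy G y x).card) ^ 3 := by rw [h1]
    _ ≤ S.card ^ 2 * ∑ y ∈ S, (S.filter fun x => Heavy G y x).card ^ 3 := h2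
    _ ≤ S.card ^ 2 * (27 * S.card ^ 3) := Nat.mul_le_mul_left _ (sum_card_heavy_pow_le hG S)
    _ = _ := by ring

end Heavy

/-! ### Half spiders and rich triples of leaves. -/

theorem card_le_of_image_of_fibre {α V : Type*} [DecidableEq V] {T : Finset α} (f g : α → V) {m k : ℕ}
    (hinj : ∀ s ∈ T, ∀ t ∈ T, f s = f t → g s = g t → s = t) (hf : (T.image f).card ≤ m)
    (hg : ∀ v, ((T.filter fun s => f s = v).image g).card ≤ k) : T.card ≤ k * m := by
  refine (Finset.card_le_mul_card_image (f := f) T k fun v _ => ?_).trans (Nat.mul_le_mul_left k hf)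
  rw [← Finset.card_image_of_injOn (f := g)]
  · exact hg v
  · intro s hs t ht h
    obtain ⟨hs, hsv⟩ := Finset.mem_filter.1 hs
    obtain ⟨ht, htv⟩ := Finset.mem_filter.1 ht
    exact hinj s hs t ht (hsv.trans htv.symm) h

section Spiders

variable {V : Type*} [Fintype V] [DecidableEq V] (G : SimpleGraph V) [DecidableRel G.Adj]

/-- The triples `(y, c, c')` for which `b - y`, `y - c - x`, `y - c' - x'` are paths forming a spider
with leaves `b`, `x`, `x'`, with few common neighbours for the pairs of vertices at distance two. -/
def halfSpiders (b x x' : V) : Finset (V × V × V) :=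
  Finset.univ.filter fun f => (G.Adj b f.1 ∧ G.Adj f.1 f.2.1 ∧ G.Adj f.1 f.2.2 ∧ G.Adj f.2.1 x ∧
    G.Adj f.2.2 x') ∧ f.2.1 ≠ f.2.2 ∧ codegree G f.1 x < 200 ∧ codegree G f.1 x' < 200 ∧
    codegree G b f.2.1 < 200 ∧ codegree G b f.2.2 < 200

/-- The leaves `b`, `x`, `x'` are joined by many half spiders. -/
def Rich (b x x' : V) : Prop := 12360000 < (halfSpiders G b x x').card

instance (b x x' : V) : Decidable (Rich G b x x') := inferInstanceAs (Decidable (_ < _))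

variable {G}

theorem mem_halfSpiders {b x x' y c c' : V} : (y, c, c') ∈ halfSpiders G b x x' ↔
    (G.Adj b y ∧ G.Adj y c ∧ G.Adj y c' ∧ G.Adj c x ∧ G.Adj c' x') ∧ c ≠ c' ∧
    codegree G y x < 200 ∧ codegree G y x' < 200 ∧ codegree G b c < 200 ∧ codegree G b c' < 200 := by
  simp [halfSpiders]

theorem card_image_le_of_common {α : Type*} {T : Finset α} (f : α → V) (u v : V)
    (h : ∀ s ∈ T, codegree G u v < 200 ∧ G.Adj u (f s) ∧ G.Adj v (f s)) :
    (T.image f).card ≤ 200 := by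
  obtain rfl | ⟨s₀, hs₀⟩ := T.eq_empty_or_nonempty
  · simp
  refine card_common_lt (h s₀ hs₀).1 fun w hw => ?_
  obtain ⟨s, hs, rfl⟩ := Finset.mem_image.1 hw
  exact (h s hs).2

/-- Once any one of `y`, `c`, `c'` is fixed, the other two can be found in turn, each as a common
neighbour of a pair of codegree below 200. The three positions give `3 * 200 ^ 2`. -/
theorem card_halfSpiders_through_le (b x x' z : V) :
    ((halfSpiders G b x x').filter fun f => z ∈ ({f.1, f.2.1, f.2.2} : Finset V)).card ≤ 120000 := by
  set H := halfSpiders G b x x' with hH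
  have e : (H.filter fun f => z ∈ ({f.1, f.2.1, f.2.2} : Finset V)) ⊆
      (H.filter fun f => f.1 = z) ∪
      ((H.filter fun f => f.2.1 = z) ∪ (H.filter fun f => f.2.2 = z)) := by
    intro f hf
    simp only [Finset.mem_filter, Finset.mem_union, Finset.mem_insert, Finset.mem_singleton] at hf ⊢
    tauto
  have h1 : (H.filter fun f => f.1 = z).card ≤ 200 * 200 := by
    refine card_le_of_image_of_fibre (fun f => f.2.1) (fun f => f.2.2) ?_
      (card_image_le_of_common (G := G) _ z x ?_) fun v => card_image_le_of_common (G := G) _ z x' ?_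
    · simp only [Finset.mem_filter]
      rintro s ⟨-, hs⟩ t ⟨-, ht⟩ h h'
      exact Prod.ext (hs.trans ht.symm) (Prod.ext h h')
    · rintro ⟨y, c, c'⟩ hf₀
      obtain ⟨hf, hz⟩ := Finset.mem_filter.1 hf₀
      subst hz
      have := mem_halfSpiders.1 hf
      exact ⟨this.2.2.1, this.1.2.1, this.1.2.2.2.1.symm⟩
    · rintro ⟨y, c, c'⟩ hf₀
      obtain ⟨hf, hz⟩ := Finset.mem_filter.1 (Finset.mem_filter.1 hf₀).1
      subst hz
      have := mem_halfSpiders.1 hf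
      exact ⟨this.2.2.2.1, this.1.2.2.1, this.1.2.2.2.2.symm⟩
  have h2 : (H.filter fun f => f.2.1 = z).card ≤ 200 * 200 := by
    refine card_le_of_image_of_fibre (fun f => f.1) (fun f => f.2.2) ?_
      (card_image_le_of_common (G := G) _ b z ?_) fun v => card_image_le_of_common (G := G) _ v x' ?_
    · simp only [Finset.mem_filter]
      rintro s ⟨-, hs⟩ t ⟨-, ht⟩ h h'
      exact Prod.ext h (Prod.ext (hs.trans ht.symm) h')
    · rintro ⟨y, c, c'⟩ hf₀
      obtain ⟨hf, hz⟩ := Finset.mem_filter.1 hf₀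
      subst hz
      have := mem_halfSpiders.1 hf
      exact ⟨this.2.2.2.2.1, this.1.1, this.1.2.1.symm⟩
    · rintro ⟨y, c, c'⟩ hf₀
      obtain ⟨hf, hz⟩ := Finset.mem_filter.1 hf₀
      subst hz
      have := mem_halfSpiders.1 (Finset.mem_filter.1 hf).1
      exact ⟨this.2.2.2.1, this.1.2.2.1, this.1.2.2.2.2.symm⟩
  have h3 : (H.filter fun f => f.2.2 = z).card ≤ 200 * 200 := by
    refine card_le_of_image_of_fibre (fun f => f.1) (fun f => f.2.1) ?_
      (card_image_le_of_common (G := G) _ b z ?_) fun v => card_image_le_of_common (G := G) _ v x ?_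
    · simp only [Finset.mem_filter]
      rintro s ⟨-, hs⟩ t ⟨-, ht⟩ h h'
      exact Prod.ext h (Prod.ext h' (hs.trans ht.symm))
    · rintro ⟨y, c, c'⟩ hf₀
      obtain ⟨hf, hz⟩ := Finset.mem_filter.1 hf₀
      subst hz
      have := mem_halfSpiders.1 hf
      exact ⟨this.2.2.2.2.2, this.1.1, this.1.2.2.1.symm⟩
    · rintro ⟨y, c, c'⟩ hf₀
      obtain ⟨hf, hz⟩ := Finset.mem_filter.1 hf₀
      subst hz
      have := mem_halfSpiders.1 (Finset.mem_filter.1 hf).1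
      exact ⟨this.2.2.1, this.1.2.1, this.1.2.2.2.1.symm⟩
  have h4 := Finset.card_le_card e
  have h5 := Finset.card_union_le (H.filter fun f => f.1 = z)
    ((H.filter fun f => f.2.1 = z) ∪ (H.filter fun f => f.2.2 = z))
  have h6 := Finset.card_union_le (H.filter fun f => f.2.1 = z) (H.filter fun f => f.2.2 = z)
  omega

/-- Pairwise disjoint spiders with the same three leaves form a subdivided biclique. -/
def SubdividedBiclique.ofSpiders {x : Fin 3 → V} {y : Fin 25 → V} {b : Fin 3 → Fin 25 → V}
    (hx : Function.Injective x) (hb : ∀ k i i', b i k = b i' k → i = i')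
    (hxb : ∀ i k, G.Adj (x i) (b i k)) (hyb : ∀ i k, G.Adj (y k) (b i k))
    (hy : ∀ i k, x i ≠ y k) (hxb' : ∀ i i' k, x i ≠ b i' k)
    (hyy : ∀ k k', k ≠ k' → y k ≠ y k') (hby : ∀ i k k', k ≠ k' → y k ≠ b i k')
    (hbb : ∀ i i' k k', k ≠ k' → b i k ≠ b i' k') : SubdividedBiclique G 3 25 where
  left := x
  right := y
  mid := b
  left_inj := hx
  right_inj := fun k k' h => by_contra fun hne => hyy k k' hne h
  mid_inj := fun i k i' k' h => by
    by_cases hk : k = k'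
    · subst hk
      exact ⟨hb k i i' h, rfl⟩
    · exact (hbb i i' k k' hk h).elim
  left_ne_right := hy
  left_ne_mid := fun i i' k => hxb' i i' k
  right_ne_mid := fun k i k' h => by
    by_cases hk : k = k'
    · subst hk
      exact (hyb i k).ne h
    · exact hby i k k' hk h
  adj_left := hxb
  adj_right := hyb

theorem injective_cons₃ {α : Type*} {a b c : α} (hab : a ≠ b) (hac : a ≠ c) (hbc : b ≠ c) :
    Function.Injective ![a, b, c] := by
  intro i j
  fin_cases i <;> fin_cases j <;> simp [hab, hac, hbc, hab.symm, hac.symm, hbc.symm]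

/-- A vertex has few neighbours that are richly joined to two given vertices. -/
theorem card_rich_le (hG : IsEmpty (SubdividedBiclique G 3 25)) {y₀ x x' : V} (h₁ : y₀ ≠ x)
    (h₂ : y₀ ≠ x') (h₃ : x ≠ x') {T : Finset V}
    (hT : ∀ b ∈ T, G.Adj y₀ b ∧ b ≠ x ∧ b ≠ x' ∧ Rich G b x x') : T.card ≤ 24 := by
  by_contra! hlt
  obtain ⟨T', hTT, hT'⟩ := Finset.exists_subset_card_eq (Nat.succ_le_of_lt hlt)
  have hT'' : T'.card = 25 := hT'
  let b : Fin 25 → V := fun k => (T'.equivFinOfCardEq hT'').symm k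
  have hb : Function.Injective b := fun k k' h =>
    (T'.equivFinOfCardEq hT'').symm.injective (Subtype.ext h)
  have hbT (k : Fin 25) := hT (b k) (hTT ((T'.equivFinOfCardEq hT'').symm k).2)
  have hZ : (Finset.univ.image b ∪ {y₀, x, x'}).card ≤ 28 := by
    have h1 := Finset.card_union_le (Finset.univ.image b) {y₀, x, x'}
    have h2 : (Finset.univ.image b).card ≤ (Finset.univ : Finset (Fin 25)).card :=
      Finset.card_image_le
    have h3 : ({y₀, x, x'} : Finset V).card ≤ 3 := Finset.card_le_three
    rw [Finset.card_fin] at h2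
    omega
  -- The threshold in `Rich` is `120000 * (28 + 25 * 3)`. The disjoint half spiders give a copy with
  -- left side `y₀, x, x'`, the centres `y` as right side, and `b k` together with the two `c`'s as
  -- subdividing vertices.
  obtain ⟨g, hg, hgZ, hgg⟩ := exists_disjoint_blocks
    (fun f : V × V × V => ({f.1, f.2.1, f.2.2} : Finset V)) 3 120000 (fun f => Finset.card_le_three)
    25 (fun k => halfSpiders G (b k) x x') (Finset.univ.image b ∪ {y₀, x, x'})
    (fun k z => card_halfSpiders_through_le _ _ _ _) fun k => by
      have := (hbT k).2.2.2
      rw [Rich] at this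
      omega
  have hg' (k) := mem_halfSpiders.1 (hg k)
  simp only [Finset.disjoint_union_right, Finset.disjoint_insert_left, Finset.disjoint_singleton_left,
    Finset.mem_image, Finset.mem_univ, true_and, not_exists, Finset.mem_insert,
    Finset.mem_singleton, not_or] at hgZ hgg
  refine hG.false (SubdividedBiclique.ofSpiders (x := ![y₀, x, x']) (y := fun k => (g k).1)
    (b := ![b, fun k => (g k).2.1, fun k => (g k).2.2]) (injective_cons₃ h₁ h₂ h₃) ?_ ?_ ?_ ?_ ?_ ?_
    ?_ ?_)
  · intro k i i' h
    have e1 := (hgZ k).1.2.1 k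
    have e2 := (hgZ k).1.2.2 k
    have e3 := (hg' k).2.1
    refine injective_cons₃ e1 e2 e3 (a₁ := i) (a₂ := i') ?_
    fin_cases i <;> fin_cases i' <;> exact h
  · intro i k
    fin_cases i
    · exact (hbT k).1
    · exact (hg' k).1.2.2.2.1.symm
    · exact (hg' k).1.2.2.2.2.symm
  · intro i k
    fin_cases i
    · exact (hg' k).1.1.symm
    · exact (hg' k).1.2.1
    · exact (hg' k).1.2.2.1
  · intro i k
    obtain ⟨-, ⟨n1, n2, n3⟩, -⟩ := hgZ k
    fin_cases i
    · exact Ne.symm n1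
    · exact Ne.symm n2
    · exact Ne.symm n3
  · intro i i' k
    obtain ⟨-, -, ⟨p1, p2, p3⟩, q1, q2, q3⟩ := hgZ k
    have hk := hbT k
    fin_cases i <;> fin_cases i'
    · exact hk.1.ne
    · exact Ne.symm p1
    · exact Ne.symm q1
    · exact hk.2.1.symm
    · exact Ne.symm p2
    · exact Ne.symm q2
    · exact hk.2.2.1.symm
    · exact Ne.symm p3
    · exact Ne.symm q3
  · intro k k' hk
    exact (hgg k k' hk).1.1
  · intro i k k' hk
    fin_cases i
    · exact Ne.symm ((hgZ k).1.1 k')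
    · exact (hgg k k' hk).1.2.1
    · exact (hgg k k' hk).1.2.2
  · intro i i' k k' hk
    obtain ⟨-, ⟨p1, p2, p3⟩, q1, q2, q3⟩ := hgg k k' hk
    fin_cases i <;> fin_cases i'
    · exact fun h => hk (hb h)
    · exact (hgZ k').1.2.1 k
    · exact (hgZ k').1.2.2 k
    · exact Ne.symm ((hgZ k).1.2.1 k')
    · exact p2
    · exact p3
    · exact Ne.symm ((hgZ k).1.2.2 k')
    · exact q2
    · exact q3

end Spiders

/-! ### Good spiders with prescribed leaves. -/

section Counting

variable {V : Type*} [Fintype V] [DecidableEq V] (G : SimpleGraph V) [DecidableRel G.Adj]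

/-- A spider with centre `y` and legs `y - u.1 - u.2`, all of whose pairs of vertices at distance two
have few common neighbours, and none of whose half spiders has richly joined leaves. -/
structure GoodSpider (y : V) (u v w : V × V) : Prop where
  adj : (G.Adj y u.1 ∧ G.Adj u.1 u.2) ∧ (G.Adj y v.1 ∧ G.Adj v.1 v.2) ∧ G.Adj y w.1 ∧ G.Adj w.1 w.2
  centre : (y ≠ u.2 ∧ y ≠ v.2 ∧ y ≠ w.2) ∧
    codegree G y u.2 < 200 ∧ codegree G y v.2 < 200 ∧ codegree G y w.2 < 200
  mid : (u.1 ≠ v.1 ∧ u.1 ≠ w.1 ∧ v.1 ≠ w.1) ∧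
    codegree G u.1 v.1 < 200 ∧ codegree G u.1 w.1 < 200 ∧ codegree G v.1 w.1 < 200
  leaf : u.2 ≠ v.2 ∧ u.2 ≠ w.2 ∧ v.2 ≠ w.2
  cross : (u.1 ≠ v.2 ∧ u.1 ≠ w.2) ∧ (v.1 ≠ u.2 ∧ v.1 ≠ w.2) ∧ w.1 ≠ u.2 ∧ w.1 ≠ v.2
  notRich : ¬ Rich G u.1 v.2 w.2 ∧ ¬ Rich G v.1 u.2 w.2 ∧ ¬ Rich G w.1 u.2 v.2

variable {G}

/-- There are boundedly many good spiders with given leaves. -/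
theorem card_goodSpider_le (hG : IsEmpty (SubdividedBiclique G 3 25)) (x₁ x₂ x₃ : V)
    {T : Finset (V × V × V × V)}
    (hT : ∀ f ∈ T, GoodSpider G f.1 (f.2.1, x₁) (f.2.2.1, x₂) (f.2.2.2, x₃)) :
    T.card ≤ 4600000000 := by
  obtain rfl | ⟨f₀, hf₀⟩ := T.eq_empty_or_nonempty
  · simp
  have hl := (hT f₀ hf₀).leaf
  by_contra! hlt
  -- With centre `z`, each middle vertex is one of fewer than 200 common neighbours of `z` and a
  -- leaf. With `z` as a middle vertex, the rest is a half spider with leaves `z` and the two other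
  -- leaves, a triple that is not rich.
  have hD : ∀ z, (T.filter fun f => z ∈ ({f.1, f.2.1, f.2.2.1, f.2.2.2} : Finset V)).card
      ≤ 200 * (200 * 200) + 3 * 12360000 := by
    intro z
    have e : (T.filter fun f => z ∈ ({f.1, f.2.1, f.2.2.1, f.2.2.2} : Finset V)) ⊆
        (T.filter fun f => f.1 = z) ∪ ((T.filter fun f => f.2.1 = z) ∪
        ((T.filter fun f => f.2.2.1 = z) ∪ (T.filter fun f => f.2.2.2 = z))) := by
      intro f hf
      simp only [Finset.mem_filter, Finset.mem_union, Finset.mem_insert, Finset.mem_singleton] at hf ⊢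
      tauto
    have h1 : (T.filter fun f => f.1 = z).card ≤ 200 * 200 * 200 := by
      obtain he | ⟨f₁, hf₁⟩ := (T.filter fun f => f.1 = z).eq_empty_or_nonempty
      · simp [he]
      obtain ⟨hf₁, hz⟩ := Finset.mem_filter.1 hf₁
      have hc := (hT f₁ hf₁).centre.2
      rw [hz] at hc
      have hmap : ((T.filter fun f => f.1 = z) : Set (V × V × V × V)).MapsTo (fun f => f.2)
          (((G.neighborFinset z ∩ G.neighborFinset x₁) ×ˢ (G.neighborFinset z ∩ G.neighborFinset x₂)
            ×ˢ (G.neighborFinset z ∩ G.neighborFinset x₃) : Finset (V × V × V)) : Set _) := by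
        intro f hf
        obtain ⟨hf, hfz⟩ := Finset.mem_filter.1 hf
        have h := (hT f hf).adj
        rw [hfz] at h
        simp only [Finset.mem_coe, Finset.mem_product, Finset.mem_inter,
          SimpleGraph.mem_neighborFinset]
        exact ⟨⟨h.1.1, h.1.2.symm⟩, ⟨h.2.1.1, h.2.1.2.symm⟩, h.2.2.1, h.2.2.2.symm⟩
      refine (Finset.card_le_card_of_injOn _ hmap fun f hf f' hf' h => ?_).trans ?_
      · exact Prod.ext ((Finset.mem_filter.1 hf).2.trans (Finset.mem_filter.1 hf').2.symm) h
      · rw [Finset.card_product, Finset.card_product, mul_assoc]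
        exact Nat.mul_le_mul hc.1.le (Nat.mul_le_mul hc.2.1.le hc.2.2.le)
    have h2 : (T.filter fun f => f.2.1 = z).card ≤ 12360000 := by
      obtain he | ⟨f₁, hf₁⟩ := (T.filter fun f => f.2.1 = z).eq_empty_or_nonempty
      · simp [he]
      obtain ⟨hf₁, hz⟩ := Finset.mem_filter.1 hf₁
      have hr := (hT f₁ hf₁).notRich.1
      rw [Rich, not_lt] at hr
      simp only [hz] at hr
      refine (Finset.card_le_card_of_injOn (fun f => (f.1, f.2.2.1, f.2.2.2)) ?_ ?_).trans hr
      · intro f hf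
        obtain ⟨hf, hfz⟩ := Finset.mem_filter.1 hf
        have h := hT f hf
        rw [hfz] at h
        exact mem_halfSpiders.2 ⟨⟨h.adj.1.1.symm, h.adj.2.1.1, h.adj.2.2.1, h.adj.2.1.2, h.adj.2.2.2⟩,
          h.mid.1.2.2, h.centre.2.2.1, h.centre.2.2.2, h.mid.2.1, h.mid.2.2.1⟩
      · rintro ⟨y, b₁, b₂, b₃⟩ hf ⟨y', b₁', b₂', b₃'⟩ hf' h
        have h1 := (Finset.mem_filter.1 hf).2
        have h2 := (Finset.mem_filter.1 hf').2
        simp_all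
    have h3 : (T.filter fun f => f.2.2.1 = z).card ≤ 12360000 := by
      obtain he | ⟨f₁, hf₁⟩ := (T.filter fun f => f.2.2.1 = z).eq_empty_or_nonempty
      · simp [he]
      obtain ⟨hf₁, hz⟩ := Finset.mem_filter.1 hf₁
      have hr := (hT f₁ hf₁).notRich.2.1
      rw [Rich, not_lt] at hr
      simp only [hz] at hr
      refine (Finset.card_le_card_of_injOn (fun f => (f.1, f.2.1, f.2.2.2)) ?_ ?_).trans hr
      · intro f hf
        obtain ⟨hf, hfz⟩ := Finset.mem_filter.1 hf
        have h := hT f hf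
        rw [hfz] at h
        exact mem_halfSpiders.2 ⟨⟨h.adj.2.1.1.symm, h.adj.1.1, h.adj.2.2.1, h.adj.1.2, h.adj.2.2.2⟩,
          h.mid.1.2.1, h.centre.2.1, h.centre.2.2.2, codegree_comm G _ z ▸ h.mid.2.1, h.mid.2.2.2⟩
      · rintro ⟨y, b₁, b₂, b₃⟩ hf ⟨y', b₁', b₂', b₃'⟩ hf' h
        have h1 := (Finset.mem_filter.1 hf).2
        have h2 := (Finset.mem_filter.1 hf').2
        simp_all
    have h4 : (T.filter fun f => f.2.2.2 = z).card ≤ 12360000 := by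
      obtain he | ⟨f₁, hf₁⟩ := (T.filter fun f => f.2.2.2 = z).eq_empty_or_nonempty
      · simp [he]
      obtain ⟨hf₁, hz⟩ := Finset.mem_filter.1 hf₁
      have hr := (hT f₁ hf₁).notRich.2.2
      rw [Rich, not_lt] at hr
      simp only [hz] at hr
      refine (Finset.card_le_card_of_injOn (fun f => (f.1, f.2.1, f.2.2.1)) ?_ ?_).trans hr
      · intro f hf
        obtain ⟨hf, hfz⟩ := Finset.mem_filter.1 hf
        have h := hT f hf
        rw [hfz] at h
        exact mem_halfSpiders.2 ⟨⟨h.adj.2.2.1.symm, h.adj.1.1, h.adj.2.1.1, h.adj.1.2, h.adj.2.1.2⟩,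
          h.mid.1.1, h.centre.2.1, h.centre.2.2.1, codegree_comm G _ z ▸ h.mid.2.2.1,
          codegree_comm G _ z ▸ h.mid.2.2.2⟩
      · rintro ⟨y, b₁, b₂, b₃⟩ hf ⟨y', b₁', b₂', b₃'⟩ hf' h
        have h1 := (Finset.mem_filter.1 hf).2
        have h2 := (Finset.mem_filter.1 hf').2
        simp_all
    have u0 := Finset.card_le_card e
    have u1 := Finset.card_union_le (T.filter fun f => f.1 = z) ((T.filter fun f => f.2.1 = z) ∪
        ((T.filter fun f => f.2.2.1 = z) ∪ (T.filter fun f => f.2.2.2 = z)))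
    have u2 := Finset.card_union_le (T.filter fun f => f.2.1 = z)
        ((T.filter fun f => f.2.2.1 = z) ∪ (T.filter fun f => f.2.2.2 = z))
    have u3 := Finset.card_union_le (T.filter fun f => f.2.2.1 = z) (T.filter fun f => f.2.2.2 = z)
    omega
  -- Here `45080000 * (25 * 4)` is below `4600000000`.
  obtain ⟨g, hg, -, hgg⟩ := exists_disjoint_blocks
    (fun f : V × V × V × V => ({f.1, f.2.1, f.2.2.1, f.2.2.2} : Finset V)) 4
    (200 * (200 * 200) + 3 * 12360000) (fun f => Finset.card_le_four)
    25 (fun _ => T) ∅ (fun k z => hD z) fun k => by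
      rw [Finset.card_empty]
      omega
  have hg' (k) := hT _ (hg k)
  simp only [Finset.disjoint_insert_left, Finset.disjoint_singleton_left,
    Finset.mem_insert, Finset.mem_singleton, not_or] at hgg
  refine hG.false (SubdividedBiclique.ofSpiders (x := ![x₁, x₂, x₃]) (y := fun k => (g k).1)
    (b := ![fun k => (g k).2.1, fun k => (g k).2.2.1, fun k => (g k).2.2.2])
    (injective_cons₃ hl.1 hl.2.1 hl.2.2) ?_ ?_ ?_ ?_ ?_ ?_ ?_ ?_)
  · intro k i i' h
    have e := (hg' k).mid.1
    refine injective_cons₃ e.1 e.2.1 e.2.2 (a₁ := i) (a₂ := i') ?_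
    fin_cases i <;> fin_cases i' <;> exact h
  · intro i k
    have := (hg' k).adj
    fin_cases i
    · exact this.1.2.symm
    · exact this.2.1.2.symm
    · exact this.2.2.2.symm
  · intro i k
    have := (hg' k).adj
    fin_cases i
    · exact this.1.1
    · exact this.2.1.1
    · exact this.2.2.1
  · intro i k
    have := (hg' k).centre.1
    fin_cases i
    · exact this.1.symm
    · exact this.2.1.symm
    · exact this.2.2.symm
  · intro i i' k
    have h1 := (hg' k).adj
    have h2 := (hg' k).cross
    fin_cases i <;> fin_cases i'
    · exact h1.1.2.ne.symm
    · exact h2.2.1.1.symm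
    · exact h2.2.2.1.symm
    · exact h2.1.1.symm
    · exact h1.2.1.2.ne.symm
    · exact h2.2.2.2.symm
    · exact h2.1.2.symm
    · exact h2.2.1.2.symm
    · exact h1.2.2.2.ne.symm
  · intro k k' hk
    exact (hgg k k' hk).1.1
  · intro i k k' hk
    have := (hgg k k' hk).1
    fin_cases i
    · exact this.2.1
    · exact this.2.2.1
    · exact this.2.2.2
  · intro i i' k k' hk
    obtain ⟨-, p, q, r⟩ := hgg k k' hk
    fin_cases i <;> fin_cases i'
    · exact p.2.1
    · exact p.2.2.1
    · exact p.2.2.2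
    · exact q.2.1
    · exact q.2.2.1
    · exact q.2.2.2
    · exact r.2.1
    · exact r.2.2.1
    · exact r.2.2.2

end Counting

/-! ### Counting all spiders, with bad ones as an error term. -/

/-- Counting triples of elements of `L` that avoid given unary, binary and ternary obstructions. -/
theorem card_pow_three_le {α : Type*} (L : Finset α) (p : α → Prop) (c : α → α → Prop)
    (t : α → α → α → Prop) [DecidablePred p] [DecidableRel c] [∀ u v w, Decidable (t u v w)] {γ : ℕ}
    (hγ : ∀ v ∈ L, ∀ w ∈ L, (L.filter fun u => t u v w).card ≤ γ) :
    L.card ^ 3 ≤ ((L ×ˢ L ×ˢ L).filter fun f => (¬ p f.1 ∧ ¬ p f.2.1 ∧ ¬ p f.2.2) ∧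
        (¬ c f.1 f.2.1 ∧ ¬ c f.1 f.2.2 ∧ ¬ c f.2.1 f.2.2) ∧
        ¬ t f.1 f.2.1 f.2.2 ∧ ¬ t f.2.1 f.1 f.2.2 ∧ ¬ t f.2.2 f.1 f.2.1).card
      + 3 * ((L.filter p).card * L.card ^ 2)
      + 3 * (((L ×ˢ L).filter fun f => c f.1 f.2).card * L.card) + 3 * (γ * L.card ^ 2) := by
  have h1 : L.card ^ 3 = ∑ _u ∈ L, ∑ _v ∈ L, ∑ _w ∈ L, 1 := by
    simp only [Finset.sum_const, smul_eq_mul]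
    ring
  have hp : (L.filter p).card = ∑ u ∈ L, if p u then 1 else 0 := by rw [Finset.card_filter]
  have hc : ((L ×ˢ L).filter fun f => c f.1 f.2).card =
      ∑ u ∈ L, ∑ v ∈ L, if c u v then 1 else 0 := by
    rw [Finset.card_filter, Finset.sum_product]
  have ht : ∑ v ∈ L, ∑ w ∈ L, ∑ u ∈ L, (if t u v w then 1 else 0) ≤ γ * L.card ^ 2 := by
    calc _ ≤ ∑ v ∈ L, ∑ w ∈ L, γ := Finset.sum_le_sum fun v hv => Finset.sum_le_sum fun w hw => by
            rw [← Finset.card_filter]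
            exact hγ v hv w hw
      _ = _ := by
        simp only [Finset.sum_const, smul_eq_mul]
        ring
  have hg : ((L ×ˢ L ×ˢ L).filter fun f => (¬ p f.1 ∧ ¬ p f.2.1 ∧ ¬ p f.2.2) ∧
        (¬ c f.1 f.2.1 ∧ ¬ c f.1 f.2.2 ∧ ¬ c f.2.1 f.2.2) ∧
        ¬ t f.1 f.2.1 f.2.2 ∧ ¬ t f.2.1 f.1 f.2.2 ∧ ¬ t f.2.2 f.1 f.2.1).card =
      ∑ u ∈ L, ∑ v ∈ L, ∑ w ∈ L, if (¬ p u ∧ ¬ p v ∧ ¬ p w) ∧ (¬ c u v ∧ ¬ c u w ∧ ¬ c v w) ∧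
        ¬ t u v w ∧ ¬ t v u w ∧ ¬ t w u v then 1 else 0 := by
    rw [Finset.card_filter, Finset.sum_product]
    refine Finset.sum_congr rfl fun u _ => ?_
    rw [Finset.sum_product]
  have p1 : ∑ u ∈ L, ∑ _v ∈ L, ∑ _w ∈ L, (if p u then 1 else 0) = (L.filter p).card * L.card ^ 2 := by
    simp only [Finset.sum_const, smul_eq_mul, ← Finset.mul_sum, ← hp]
    ring
  have p2 : ∑ _u ∈ L, ∑ v ∈ L, ∑ _w ∈ L, (if p v then 1 else 0) = (L.filter p).card * L.card ^ 2 := by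
    simp only [Finset.sum_const, smul_eq_mul, ← Finset.mul_sum, ← hp]
    ring
  have p3 : ∑ _u ∈ L, ∑ _v ∈ L, ∑ w ∈ L, (if p w then 1 else 0) = (L.filter p).card * L.card ^ 2 := by
    simp only [Finset.sum_const, smul_eq_mul, ← hp]
    ring
  have c1 : ∑ u ∈ L, ∑ v ∈ L, ∑ _w ∈ L, (if c u v then 1 else 0) =
      ((L ×ˢ L).filter fun f => c f.1 f.2).card * L.card := by
    simp only [Finset.sum_const, smul_eq_mul, ← Finset.mul_sum, ← hc]
    ring
  have c2 : ∑ u ∈ L, ∑ _v ∈ L, ∑ w ∈ L, (if c u w then 1 else 0) =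
      ((L ×ˢ L).filter fun f => c f.1 f.2).card * L.card := by
    simp only [Finset.sum_const, smul_eq_mul, ← Finset.mul_sum, ← hc]
    ring
  have c3 : ∑ _u ∈ L, ∑ v ∈ L, ∑ w ∈ L, (if c v w then 1 else 0) =
      ((L ×ˢ L).filter fun f => c f.1 f.2).card * L.card := by
    simp only [Finset.sum_const, smul_eq_mul, ← hc]
    ring
  have t1 : ∑ u ∈ L, ∑ v ∈ L, ∑ w ∈ L, (if t u v w then 1 else 0) ≤ γ * L.card ^ 2 := by
    refine le_trans (le_of_eq ?_) ht
    rw [Finset.sum_comm]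
    exact Finset.sum_congr rfl fun v _ => Finset.sum_comm
  have t2 : ∑ u ∈ L, ∑ v ∈ L, ∑ w ∈ L, (if t v u w then 1 else 0) ≤ γ * L.card ^ 2 := by
    refine le_trans (le_of_eq ?_) ht
    exact Finset.sum_congr rfl fun v _ => Finset.sum_comm
  have t3 : ∑ u ∈ L, ∑ v ∈ L, ∑ w ∈ L, (if t w u v then 1 else 0) ≤ γ * L.card ^ 2 := ht
  rw [hg, h1]
  calc _ ≤ ∑ u ∈ L, ∑ v ∈ L, ∑ w ∈ L, ((if (¬ p u ∧ ¬ p v ∧ ¬ p w) ∧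
        (¬ c u v ∧ ¬ c u w ∧ ¬ c v w) ∧ ¬ t u v w ∧ ¬ t v u w ∧ ¬ t w u v then 1 else 0)
        + ((if p u then 1 else 0) + (if p v then 1 else 0) + (if p w then 1 else 0))
        + ((if c u v then 1 else 0) + (if c u w then 1 else 0) + (if c v w then 1 else 0))
        + ((if t u v w then 1 else 0) + (if t v u w then 1 else 0) + (if t w u v then 1 else 0))) := by
        refine Finset.sum_le_sum fun u _ => Finset.sum_le_sum fun v _ => Finset.sum_le_sum
          fun w _ => ?_
        by_cases h : (¬ p u ∧ ¬ p v ∧ ¬ p w) ∧ (¬ c u v ∧ ¬ c u w ∧ ¬ c v w) ∧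
          ¬ t u v w ∧ ¬ t v u w ∧ ¬ t w u v
        · rw [if_pos h]; omega
        · rw [if_neg h]
          by_cases q1 : p u
          · rw [if_pos q1]; omega
          by_cases q2 : p v
          · rw [if_pos q2]; omega
          by_cases q3 : p w
          · rw [if_pos q3]; omega
          by_cases q4 : c u v
          · rw [if_pos q4]; omega
          by_cases q5 : c u w
          · rw [if_pos q5]; omega
          by_cases q6 : c v w
          · rw [if_pos q6]; omega
          by_cases q7 : t u v w
          · rw [if_pos q7]; omega
          by_cases q8 : t v u w
          · rw [if_pos q8]; omega
          by_cases q9 : t w u v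
          · rw [if_pos q9]; omega
          exact (h ⟨⟨q1, q2, q3⟩, ⟨q4, q5, q6⟩, q7, q8, q9⟩).elim
    _ ≤ _ := by
      simp only [Finset.sum_add_distrib]
      rw [p1, p2, p3, c1, c2, c3]
      omega

section Legs

/-- The walks of length two starting at a vertex. -/
def legs {V : Type*} [Fintype V] (G : SimpleGraph V) [DecidableRel G.Adj] (y : V) : Finset (V × V) :=
  Finset.univ.filter fun u => G.Adj y u.1 ∧ G.Adj u.1 u.2

theorem mem_legs {V : Type*} [Fintype V] {G : SimpleGraph V} [DecidableRel G.Adj] 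
    {y : V} {u : V × V} : u ∈ legs G y ↔ G.Adj y u.1 ∧ G.Adj u.1 u.2 := by simp [legs]

variable {V : Type*} [Fintype V] {G : SimpleGraph V} [DecidableRel G.Adj]

theorem card_legs_filter (y : V) (q : V × V → Prop) [DecidablePred q] : ((legs G y).filter q).card =
    ∑ b ∈ G.neighborFinset y, ((G.neighborFinset b).filter fun x => q (b, x)).card := by
  rw [← Finset.card_sigma]
  refine Finset.card_bij (fun u _ => ⟨u.1, u.2⟩) ?_ ?_ ?_
  · rintro ⟨b, x⟩ h
    simpa [mem_legs, and_assoc] using h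
  · rintro ⟨b, x⟩ - ⟨b', x'⟩ - h
    simpa using h
  · rintro ⟨b, x⟩ h
    exact ⟨(b, x), by simpa [mem_legs, and_assoc] using h, rfl⟩

theorem card_legs (y : V) : (legs G y).card = ∑ b ∈ G.neighborFinset y, G.degree b := by
  simpa using card_legs_filter (G := G) y fun _ => True

theorem card_legs_le {Δ : ℕ} (hΔ : ∀ v, G.degree v ≤ Δ) (y : V) : (legs G y).card ≤ Δ ^ 2 := by
  rw [card_legs, sq]
  exact (Finset.sum_le_card_nsmul _ _ _ fun b _ => hΔ b).trans (Nat.mul_le_mul_right Δ (hΔ y))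

variable [DecidableEq V]

theorem card_legs_fst_le {Δ : ℕ} (hΔ : ∀ v, G.degree v ≤ Δ) (y z : V) :
    ((legs G y).filter fun u => u.1 = z).card ≤ Δ := by
  refine (Finset.card_le_card_of_injOn Prod.snd (t := G.neighborFinset z) ?_ ?_).trans (hΔ z)
  · intro u hu
    obtain ⟨hu', rfl⟩ := Finset.mem_filter.1 hu
    simpa using (mem_legs.1 hu').2
  · intro u hu v hv h
    exact Prod.ext ((Finset.mem_filter.1 hu).2.trans (Finset.mem_filter.1 hv).2.symm) h

theorem card_legs_snd_le {Δ : ℕ} (hΔ : ∀ v, G.degree v ≤ Δ) (y z : V) :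
    ((legs G y).filter fun u => u.2 = z).card ≤ Δ := by
  refine (Finset.card_le_card_of_injOn Prod.fst (t := G.neighborFinset z) ?_ ?_).trans (hΔ z)
  · intro u hu
    obtain ⟨hu', rfl⟩ := Finset.mem_filter.1 hu
    simpa using (mem_legs.1 hu').2.symm
  · intro u hu v hv h
    exact Prod.ext h ((Finset.mem_filter.1 hu).2.trans (Finset.mem_filter.1 hv).2.symm)

end Legs

section Counting

variable {V : Type*} [Fintype V] [DecidableEq V] {G : SimpleGraph V} [DecidableRel G.Adj]

/-- Summing over the middle vertex `b` instead of `y` places both ends of the leg in the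
neighbourhood of `b`, where heavy pairs are controlled. -/
theorem sum_card_legs_heavy_le {Δ H : ℕ} (hΔ : ∀ v, G.degree v ≤ Δ)
    (hH : ∀ v, ((G.neighborFinset v ×ˢ G.neighborFinset v).filter fun p => Heavy G p.1 p.2).card ≤ H) :
    ∑ y, ((legs G y).filter fun u => y = u.2 ∨ Heavy G y u.2).card ≤ Fintype.card V * (Δ + H) := by
  simp_rw [card_legs_filter]
  rw [Finset.sum_comm' (t' := Finset.univ) (s' := fun b => G.neighborFinset b)
    (by simp [SimpleGraph.adj_comm])]
  refine (Finset.sum_le_card_nsmul _ _ (Δ + H) fun b _ => ?_).trans (by simp)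
  calc ∑ y ∈ G.neighborFinset b, ((G.neighborFinset b).filter fun x => y = x ∨ Heavy G y x).card
      ≤ ∑ y ∈ G.neighborFinset b, (1 + ((G.neighborFinset b).filter fun x => Heavy G y x).card) := by
        refine Finset.sum_le_sum fun y _ => ?_
        rw [Finset.filter_or]
        refine (Finset.card_union_le _ _).trans (Nat.add_le_add_right ?_ _)
        exact Finset.card_le_one.2 fun u hu v hv =>
          (Finset.mem_filter.1 hu).2.symm.trans (Finset.mem_filter.1 hv).2
    _ = G.degree b +
        ((G.neighborFinset b ×ˢ G.neighborFinset b).filter fun p => Heavy G p.1 p.2).card := by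
        rw [Finset.sum_add_distrib, Finset.card_filter _ (_ ×ˢ _), Finset.sum_product]
        simp_rw [Finset.card_filter]
        simp
    _ ≤ Δ + H := Nat.add_le_add (hΔ b) (hH b)

variable (G) in
/-- Two legs of a spider that meet or whose first vertices have many common neighbours. -/
def LegConflict (u v : V × V) : Prop :=
  (u.1 = v.1 ∨ u.1 = v.2 ∨ u.2 = v.1 ∨ u.2 = v.2) ∨ Heavy G u.1 v.1

instance : DecidableRel (LegConflict G) := fun _ _ => inferInstanceAs (Decidable (_ ∨ _))

/-- Each of the four coincidences leaves at most `Δ` choices for the second leg. Otherwise the first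
vertices form a heavy pair among the neighbours of `y`, extended in at most `Δ * Δ` ways. -/
theorem card_legConflict_le {Δ H : ℕ} (hΔ : ∀ v, G.degree v ≤ Δ)
    (hH : ∀ v, ((G.neighborFinset v ×ˢ G.neighborFinset v).filter fun p => Heavy G p.1 p.2).card ≤ H)
    (y : V) : ((legs G y ×ˢ legs G y).filter fun f => LegConflict G f.1 f.2).card ≤
      4 * Δ * Δ ^ 2 + Δ * Δ * H := by
  have e : ((legs G y ×ˢ legs G y).filter fun f => LegConflict G f.1 f.2) ⊆
      ((legs G y ×ˢ legs G y).filter fun f =>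
        f.1.1 = f.2.1 ∨ f.1.1 = f.2.2 ∨ f.1.2 = f.2.1 ∨ f.1.2 = f.2.2) ∪
      ((legs G y ×ˢ legs G y).filter fun f => Heavy G f.1.1 f.2.1) := fun f hf => by
    obtain ⟨hf, h | h⟩ := Finset.mem_filter.1 hf
    · exact Finset.mem_union_left _ (Finset.mem_filter.2 ⟨hf, h⟩)
    · exact Finset.mem_union_right _ (Finset.mem_filter.2 ⟨hf, h⟩)
  refine (Finset.card_le_card e).trans ?_
  refine (Finset.card_union_le _ _).trans (Nat.add_le_add ?_ ?_)
  · refine (Finset.card_le_mul_card_image_of_maps_to (f := Prod.fst) (t := legs G y)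
      (fun f hf => (Finset.mem_product.1 (Finset.mem_filter.1 hf).1).1) (4 * Δ) fun u hu => ?_).trans
      (Nat.mul_le_mul_left _ (card_legs_le hΔ y))
    have : (Finset.filter (fun f => f.1 = u) ((legs G y ×ˢ legs G y).filter fun f =>
        f.1.1 = f.2.1 ∨ f.1.1 = f.2.2 ∨ f.1.2 = f.2.1 ∨ f.1.2 = f.2.2)).card ≤
        (((legs G y).filter fun v => v.1 = u.1) ∪ (((legs G y).filter fun v => v.2 = u.1) ∪
          (((legs G y).filter fun v => v.1 = u.2) ∪ ((legs G y).filter fun v => v.2 = u.2)))).card := by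
      refine Finset.card_le_card_of_injOn Prod.snd ?_ ?_
      · rintro ⟨u', v⟩ hf
        simp only [Finset.coe_filter, Finset.mem_filter, Finset.mem_product, Set.mem_ofPred_eq] at hf
        obtain ⟨⟨⟨-, hv⟩, hc⟩, rfl⟩ := hf
        simp only [Finset.coe_union, Set.mem_union, Finset.mem_coe, Finset.mem_filter]
        tauto
      · intro f hf f' hf' h
        exact Prod.ext ((Finset.mem_filter.1 hf).2.trans (Finset.mem_filter.1 hf').2.symm) h
    have u1 := Finset.card_union_le ((legs G y).filter fun v => v.1 = u.1)
      (((legs G y).filter fun v => v.2 = u.1) ∪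
          (((legs G y).filter fun v => v.1 = u.2) ∪ ((legs G y).filter fun v => v.2 = u.2)))
    have u2 := Finset.card_union_le ((legs G y).filter fun v => v.2 = u.1)
          (((legs G y).filter fun v => v.1 = u.2) ∪ ((legs G y).filter fun v => v.2 = u.2))
    have u3 := Finset.card_union_le ((legs G y).filter fun v => v.1 = u.2)
      ((legs G y).filter fun v => v.2 = u.2)
    have w1 := card_legs_fst_le hΔ y u.1
    have w2 := card_legs_snd_le hΔ y u.1
    have w3 := card_legs_fst_le hΔ y u.2
    have w4 := card_legs_snd_le hΔ y u.2
    omega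
  · refine (Finset.card_le_mul_card_image_of_maps_to (f := fun f => (f.1.1, f.2.1))
      (t := (G.neighborFinset y ×ˢ G.neighborFinset y).filter fun p => Heavy G p.1 p.2)
      (fun f hf => ?_) (Δ * Δ) fun p hp => ?_).trans (Nat.mul_le_mul_left _ (hH y))
    · simp only [Finset.mem_filter, Finset.mem_product, mem_legs] at hf
      simp only [Finset.mem_filter, Finset.mem_product, SimpleGraph.mem_neighborFinset]
      exact ⟨⟨hf.1.1.1, hf.1.2.1⟩, hf.2⟩
    · refine le_trans (Finset.card_le_card (t := ((legs G y).filter fun u => u.1 = p.1) ×ˢ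
        ((legs G y).filter fun u => u.1 = p.2)) fun f hf => ?_) ?_
      · simp only [Finset.mem_filter, Finset.mem_product] at hf ⊢
        obtain ⟨⟨⟨h1, h2⟩, -⟩, rfl⟩ := hf
        exact ⟨⟨h1, rfl⟩, h2, rfl⟩
      · rw [Finset.card_product]
        exact Nat.mul_le_mul (card_legs_fst_le hΔ y _) (card_legs_fst_le hΔ y _)

theorem card_legs_rich_le (hG : IsEmpty (SubdividedBiclique G 3 25)) {Δ : ℕ}
    (hΔ : ∀ v, G.degree v ≤ Δ) (y x x' : V) :
    ((legs G y).filter fun u => (y ≠ x ∧ y ≠ x' ∧ x ≠ x' ∧ u.1 ≠ x ∧ u.1 ≠ x') ∧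
      Rich G u.1 x x').card ≤ Δ * 24 := by
  obtain he | ⟨u₀, hu₀⟩ := ((legs G y).filter fun u => (y ≠ x ∧ y ≠ x' ∧ x ≠ x' ∧ u.1 ≠ x ∧
    u.1 ≠ x') ∧ Rich G u.1 x x').eq_empty_or_nonempty
  · simp [he]
  obtain ⟨-, ⟨h1, h2, h3, -⟩, -⟩ := Finset.mem_filter.1 hu₀
  refine (Finset.card_le_mul_card_image (f := Prod.fst) _ Δ fun z _ => ?_).trans
    (Nat.mul_le_mul_left Δ (card_rich_le hG h1 h2 h3 fun b hb => ?_))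
  · refine le_trans (Finset.card_le_card fun u hu => ?_) (card_legs_fst_le hΔ y z)
    exact Finset.mem_filter.2 ⟨(Finset.mem_filter.1 (Finset.mem_filter.1 hu).1).1,
      (Finset.mem_filter.1 hu).2⟩
  · obtain ⟨u, hu, rfl⟩ := Finset.mem_image.1 hb
    obtain ⟨hu, ⟨-, -, -, h4, h5⟩, h6⟩ := Finset.mem_filter.1 hu
    exact ⟨(mem_legs.1 hu).1, h4, h5, h6⟩

theorem not_heavy {u v : V} (h : u ≠ v) (h' : ¬ Heavy G u v) : codegree G u v < 200 := by
  by_contra hc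
  exact h' ⟨h, not_lt.1 hc⟩

theorem card_goodSpiders_le (hG : IsEmpty (SubdividedBiclique G 3 25))
    {T : Finset (V × (V × V) × (V × V) × (V × V))}
    (hT : ∀ f ∈ T, GoodSpider G f.1 f.2.1 f.2.2.1 f.2.2.2) :
    T.card ≤ 4600000000 * Fintype.card V ^ 3 := by
  have h := Finset.card_le_mul_card_image_of_maps_to (f := fun f : V × (V × V) × (V × V) × (V × V) =>
    (f.2.1.2, f.2.2.1.2, f.2.2.2.2)) (s := T) (t := Finset.univ) (fun _ _ => Finset.mem_univ _)
    4600000000 fun x _ => ?_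
  · refine h.trans (le_of_eq ?_)
    simp only [Finset.card_univ, Fintype.card_prod]
    ring
  · rw [← Finset.card_image_of_injOn (f := fun f : V × (V × V) × (V × V) × (V × V) =>
      (f.1, f.2.1.1, f.2.2.1.1, f.2.2.2.1))]
    · refine card_goodSpider_le hG x.1 x.2.1 x.2.2 fun f hf => ?_
      obtain ⟨⟨y, u, v, w⟩, hg, rfl⟩ := Finset.mem_image.1 hf
      obtain ⟨hg', rfl⟩ := Finset.mem_filter.1 hg
      exact hT _ hg'
    · rintro ⟨y, ⟨b₁, z₁⟩, ⟨b₂, z₂⟩, b₃, z₃⟩ hf ⟨y', ⟨b₁', z₁'⟩, ⟨b₂', z₂'⟩, b₃', z₃'⟩ hf' h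
      have h1 := (Finset.mem_filter.1 hf).2.trans (Finset.mem_filter.1 hf').2.symm
      simp only [Prod.mk.injEq] at h h1 ⊢
      tauto

/-- The number of spiders with three legs of length two, in a graph of bounded maximum degree that
contains no subdivided `K_{3,25}`. -/
theorem sum_card_legs_pow_le (hG : IsEmpty (SubdividedBiclique G 3 25)) {Δ H : ℕ}
    (hΔ : ∀ v, G.degree v ≤ Δ)
    (hH : ∀ v, ((G.neighborFinset v ×ˢ G.neighborFinset v).filter fun p => Heavy G p.1 p.2).card ≤ H) :
    ∑ y, (legs G y).card ^ 3 ≤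
      4600000000 * Fintype.card V ^ 3 + Fintype.card V * Δ ^ 4 * (87 * Δ + 6 * H) := by
  classical
  let good (y : V) : Finset ((V × V) × (V × V) × (V × V)) :=
    (legs G y ×ˢ legs G y ×ˢ legs G y).filter fun f => GoodSpider G y f.1 f.2.1 f.2.2
  have h1 : ∀ y, (legs G y).card ^ 3 ≤ (good y).card
      + 3 * ((((legs G y).filter fun u => y = u.2 ∨ Heavy G y u.2).card) * (Δ ^ 2) ^ 2)
      + 3 * ((4 * Δ * Δ ^ 2 + Δ * Δ * H) * Δ ^ 2) + 3 * (Δ * 24 * (Δ ^ 2) ^ 2) := by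
    intro y
    have hL := card_legs_le hΔ y
    -- The ternary obstruction includes the distinctness needed by `card_rich_le`. Nothing is lost,
    -- as triples violating it are already discarded by the unary and binary obstructions.
    refine (card_pow_three_le (legs G y) (fun u => y = u.2 ∨ Heavy G y u.2) (LegConflict G)
      (fun u v w => (y ≠ v.2 ∧ y ≠ w.2 ∧ v.2 ≠ w.2 ∧ u.1 ≠ v.2 ∧ u.1 ≠ w.2) ∧ Rich G u.1 v.2 w.2)
      (γ := Δ * 24) fun v _ w _ => card_legs_rich_le hG hΔ y v.2 w.2).trans ?_
    refine Nat.add_le_add (Nat.add_le_add (Nat.add_le_add (Finset.card_le_card ?_) ?_) ?_) ?_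
    · rintro ⟨u, v, w⟩ hf
      simp only [Finset.mem_filter, Finset.mem_product, mem_legs, LegConflict, not_or] at hf
      obtain ⟨hadj, ⟨⟨p1, q1⟩, ⟨p2, q2⟩, p3, q3⟩, ⟨⟨⟨a1, a2, a3, a4⟩, a5⟩, ⟨⟨b1, b2, b3, b4⟩, b5⟩,
        ⟨c1, c2, c3, c4⟩, c5⟩, r1, r2, r3⟩ := hf
      refine Finset.mem_filter.2 ⟨by simpa only [Finset.mem_product, mem_legs] using hadj, ?_⟩
      refine ⟨hadj, ⟨⟨p1, p2, p3⟩, not_heavy p1 q1, not_heavy p2 q2, not_heavy p3 q3⟩,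
        ⟨⟨a1, b1, c1⟩, not_heavy a1 a5, not_heavy b1 b5, not_heavy c1 c5⟩, ⟨a4, b4, c4⟩,
        ⟨⟨a2, b2⟩, ⟨Ne.symm a3, c2⟩, Ne.symm b3, Ne.symm c3⟩, ?_, ?_, ?_⟩
      · exact fun h => r1 ⟨⟨p2, p3, c4, a2, b2⟩, h⟩
      · exact fun h => r2 ⟨⟨p1, p3, b4, Ne.symm a3, c2⟩, h⟩
      · exact fun h => r3 ⟨⟨p1, p2, a4, Ne.symm b3, Ne.symm c3⟩, h⟩
    · gcongr
    · gcongr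
      exact card_legConflict_le hΔ hH y
    · gcongr
  have h2 : ∑ y, (good y).card ≤ 4600000000 * Fintype.card V ^ 3 := by
    rw [← Finset.card_sigma, ← Finset.card_image_of_injOn
      (f := fun f : (_ : V) × ((V × V) × (V × V) × (V × V)) => (f.1, f.2))]
    · refine card_goodSpiders_le hG fun f hf => ?_
      obtain ⟨g, hg, rfl⟩ := Finset.mem_image.1 hf
      exact (Finset.mem_filter.1 (Finset.mem_sigma.1 hg).2).2
    · rintro ⟨y, f⟩ - ⟨y', f'⟩ - h
      simpa using h
  have h3 := sum_card_legs_heavy_le hΔ hH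
  calc ∑ y, (legs G y).card ^ 3 ≤ ∑ y, ((good y).card
      + 3 * ((((legs G y).filter fun u => y = u.2 ∨ Heavy G y u.2).card) * (Δ ^ 2) ^ 2)
      + 3 * ((4 * Δ * Δ ^ 2 + Δ * Δ * H) * Δ ^ 2) + 3 * (Δ * 24 * (Δ ^ 2) ^ 2)) :=
        Finset.sum_le_sum fun y _ => h1 y
    _ = ∑ y, (good y).card
      + 3 * ((∑ y, (((legs G y).filter fun u => y = u.2 ∨ Heavy G y u.2).card)) * (Δ ^ 2) ^ 2)
      + Fintype.card V * (3 * ((4 * Δ * Δ ^ 2 + Δ * Δ * H) * Δ ^ 2) + 3 * (Δ * 24 * (Δ ^ 2) ^ 2)) := by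
        simp only [Finset.sum_add_distrib, Finset.sum_const, smul_eq_mul, Finset.sum_mul,
          Finset.mul_sum, Finset.card_univ]
        ring
    _ ≤ 4600000000 * Fintype.card V ^ 3 + 3 * (Fintype.card V * (Δ + H) * (Δ ^ 2) ^ 2)
      + Fintype.card V * (3 * ((4 * Δ * Δ ^ 2 + Δ * Δ * H) * Δ ^ 2) + 3 * (Δ * 24 * (Δ ^ 2) ^ 2)) := by
        gcongr
    -- The coefficients are `87 = 3 + 12 + 72` and `6 = 3 + 3`.
    _ = _ := by ring

end Counting

/-! ### The bound for graphs of comparable maximum and average degree. -/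

section MaxDegree

variable {V : Type*} [Fintype V] [DecidableEq V] {G : SimpleGraph V} [DecidableRel G.Adj]

/-- The power mean inequality is used twice, for degrees and for the numbers of walks of length two
from a vertex. -/
theorem sum_degree_pow_six_le {V : Type*} [Fintype V] {G : SimpleGraph V} [DecidableRel G.Adj] :
    (∑ v, G.degree v) ^ 6 ≤ Fintype.card V ^ 5 * ∑ y, (legs G y).card ^ 3 := by
  have h1 : ∑ y, (legs G y).card = ∑ b, G.degree b ^ 2 := by
    simp_rw [card_legs]
    rw [Finset.sum_comm' (t' := Finset.univ) (s' := fun b => G.neighborFinset b)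
      (by simp [SimpleGraph.adj_comm])]
    simp [sq]
  have h2 : (∑ v, G.degree v) ^ 2 ≤ Fintype.card V * ∑ b, G.degree b ^ 2 := by
    simpa using pow_sum_le_card_mul_sum_pow (s := Finset.univ) (f := fun v => G.degree v)
      (fun _ _ => Nat.zero_le _) 1
  have h3 : (∑ y, (legs G y).card) ^ 3 ≤ Fintype.card V ^ 2 * ∑ y, (legs G y).card ^ 3 := by
    simpa using pow_sum_le_card_mul_sum_pow (s := Finset.univ) (f := fun y => (legs G y).card)
      (fun _ _ => Nat.zero_le _) 2
  calc (∑ v, G.degree v) ^ 6 = ((∑ v, G.degree v) ^ 2) ^ 3 := by ring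
    _ ≤ (Fintype.card V * ∑ b, G.degree b ^ 2) ^ 3 := by gcongr
    _ = Fintype.card V ^ 3 * (∑ y, (legs G y).card) ^ 3 := by rw [h1]; ring
    _ ≤ Fintype.card V ^ 3 * (Fintype.card V ^ 2 * ∑ y, (legs G y).card ^ 3) := by gcongr
    _ = _ := by ring

/-- If the conclusion failed, each of the three terms on the right of `h` would be at most `D ^ 6 /
4`. The exponent 17 comes from cubing the `H` term, which yields `Δ ^ 12 * Δ ^ 5`. -/
theorem average_degree_bound {D n Δ H κ : ℝ} (hn : 1 ≤ n) (hκ : 1 ≤ κ) (hΔ₀ : 0 ≤ Δ)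
    (hΔ : Δ ≤ κ * D) (hH : H ^ 3 ≤ 27 * Δ ^ 5)
    (h : D ^ 6 ≤ 4600000000 * n ^ 2 + Δ ^ 4 * (87 * Δ + 6 * H)) :
    D ^ 3 ≤ (10 ^ 6 * κ ^ 17) ^ 3 * n := by
  by_contra! hlt
  set M := 10 ^ 6 * κ ^ 17 with hM
  have hκ17 : 1 ≤ κ ^ 17 := one_le_pow₀ hκ
  have hM6 : 10 ^ 6 ≤ M := by rw [hM]; linarith
  have hD₀ : 0 ≤ D := by
    by_contra! hneg
    nlinarith
  have hDM : M ≤ D := by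
    refine le_of_pow_le_pow_left₀ (n := 3) (by norm_num) hD₀ (le_trans ?_ hlt.le)
    exact le_mul_of_one_le_right (by positivity) hn
  have hD : 0 < D := by linarith
  have e1 : 4600000000 * n ^ 2 ≤ D ^ 6 / 4 := by
    have a1 : (M ^ 3 * n) ^ 2 ≤ (D ^ 3) ^ 2 := by gcongr
    have a2 : ((10 ^ 6 : ℝ) ^ 3 * n) ^ 2 ≤ (M ^ 3 * n) ^ 2 := by gcongr
    have a3 := a2.trans a1
    ring_nf at a3 ⊢
    nlinarith [sq_nonneg n]
  have e2 : Δ ^ 4 * (87 * Δ) ≤ D ^ 6 / 4 := by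
    have a1 : Δ ^ 5 ≤ (κ * D) ^ 5 := by gcongr
    have a2 : κ ^ 5 ≤ κ ^ 17 := pow_le_pow_right₀ hκ (by norm_num)
    have a3 : 348 * κ ^ 5 ≤ D := by rw [hM] at hDM; linarith
    have a4 : 348 * κ ^ 5 * D ^ 5 ≤ D * D ^ 5 := by gcongr
    rw [mul_pow] at a1
    linarith [show D * D ^ 5 = D ^ 6 by ring, show Δ ^ 4 * (87 * Δ) = 87 * Δ ^ 5 by ring]
  have e3 : Δ ^ 4 * (6 * H) ≤ D ^ 6 / 4 := by
    refine le_of_pow_le_pow_left₀ (n := 3) (by norm_num) (by positivity) ?_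
    have a1 : Δ ^ 17 ≤ (κ * D) ^ 17 := by gcongr
    have a2 : 373248 * κ ^ 17 ≤ D := by rw [hM] at hDM; linarith
    have a3 : 373248 * κ ^ 17 * D ^ 17 ≤ D * D ^ 17 := by gcongr
    have a4 : Δ ^ 12 * H ^ 3 ≤ Δ ^ 12 * (27 * Δ ^ 5) := by gcongr
    rw [mul_pow] at a1
    linarith [show (Δ ^ 4 * (6 * H)) ^ 3 = 216 * (Δ ^ 12 * H ^ 3) by ring,
      show (D ^ 6 / 4) ^ 3 = D * D ^ 17 / 64 by ring,
      show Δ ^ 12 * (27 * Δ ^ 5) = 27 * Δ ^ 17 by ring]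
  have hD6 : 0 < D ^ 6 := by positivity
  linarith [show Δ ^ 4 * (87 * Δ + 6 * H) = Δ ^ 4 * (87 * Δ) + Δ ^ 4 * (6 * H) by ring]

/-- The bound for graphs whose maximum degree is comparable to the average degree. -/
theorem sum_degree_pow_le_of_degree_le [Nonempty V] (hG : IsEmpty (SubdividedBiclique G 3 25)) {κ : ℕ}
    (hκ : 1 ≤ κ) (hd : ∀ v, Fintype.card V * G.degree v ≤ κ * ∑ v, G.degree v) :
    (∑ v, G.degree v) ^ 3 ≤ (10 ^ 6 * κ ^ 17) ^ 3 * Fintype.card V ^ 4 := by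
  set s := ∑ v, G.degree v with hs
  set n := Fintype.card V with hn
  have hn₀ : 0 < n := Fintype.card_pos
  set H := Finset.univ.sup fun v =>
    ((G.neighborFinset v ×ˢ G.neighborFinset v).filter fun p => Heavy G p.1 p.2).card with hHdef
  have hH (v) : ((G.neighborFinset v ×ˢ G.neighborFinset v).filter
      fun p => Heavy G p.1 p.2).card ≤ H := Finset.le_sup (f := fun v =>
    ((G.neighborFinset v ×ˢ G.neighborFinset v).filter fun p => Heavy G p.1 p.2).card)
      (Finset.mem_univ v)
  have hH3 : H ^ 3 ≤ 27 * G.maxDegree ^ 5 := by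
    obtain ⟨v, -, hv⟩ := Finset.exists_mem_eq_sup Finset.univ Finset.univ_nonempty fun v =>
      ((G.neighborFinset v ×ˢ G.neighborFinset v).filter fun p => Heavy G p.1 p.2).card
    rw [hHdef, hv]
    refine (card_heavy_pairs_pow_le hG _).trans ?_
    gcongr
    exact G.degree_le_maxDegree v
  have hmax : n * G.maxDegree ≤ κ * s := by
    obtain ⟨v, hv⟩ := G.exists_maximal_degree_vertex
    rw [hv]
    exact hd v
  have main := sum_degree_pow_six_le (G := G).trans (Nat.mul_le_mul_left _
    (sum_card_legs_pow_le hG (fun v => G.degree_le_maxDegree v) hH))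
  rw [← hs, ← hn] at main
  generalize G.maxDegree = Δ at *
  have hnR : (0 : ℝ) < n := by exact_mod_cast hn₀
  have key := average_degree_bound (D := s / n) (n := n) (Δ := Δ) (H := H) (κ := κ)
    (by exact_mod_cast hn₀) (by exact_mod_cast hκ) (by positivity)
    (by
      rw [← mul_div_assoc, le_div_iff₀ hnR]
      have : (n * Δ : ℝ) ≤ κ * s := by exact_mod_cast hmax
      linarith)
    (by exact_mod_cast hH3)
    (by
      have h : (s : ℝ) ^ 6 ≤ n ^ 5 * (4600000000 * n ^ 3 + n * Δ ^ 4 * (87 * Δ + 6 * H)) := by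
        exact_mod_cast main
      rw [div_pow, div_le_iff₀ (by positivity)]
      refine h.trans (le_of_eq ?_)
      ring)
  rw [div_pow, div_le_iff₀ (by positivity)] at key
  have : (s : ℝ) ^ 3 ≤ (10 ^ 6 * κ ^ 17) ^ 3 * n ^ 4 := key.trans (le_of_eq (by ring))
  exact_mod_cast this

end MaxDegree

/-! ### Removing the degree assumption by induction. -/

theorem sum_le_of_cover {α ι : Type*} [Fintype α] [Fintype ι] (f g : α → α → ℕ)
    (h : ι → α → α → ℕ) (hfg : ∀ u v, f u v ≤ g u v + ∑ i, h i u v) :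
    ∑ u, ∑ v, f u v ≤ ∑ u, ∑ v, g u v + ∑ i, ∑ u, ∑ v, h i u v := by
  refine (Finset.sum_le_sum fun u _ => Finset.sum_le_sum fun v _ => hfg u v).trans (le_of_eq ?_)
  simp only [Finset.sum_add_distrib]
  refine congrArg _ ?_
  rw [Finset.sum_comm (s := (Finset.univ : Finset ι))]
  exact Finset.sum_congr rfl fun u _ => Finset.sum_comm

section Induction

theorem sum_degree_eq {V : Type*} [Fintype V] (G : SimpleGraph V) [DecidableRel G.Adj] :
    ∑ v, G.degree v = ∑ u, ∑ v, if G.Adj u v then 1 else 0 := by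
  refine Finset.sum_congr rfl fun u _ => ?_
  rw [← Finset.card_filter, ← SimpleGraph.card_neighborFinset_eq_degree,
    SimpleGraph.neighborFinset_eq_filter]

theorem isEmpty_subdividedBiclique_of_isContained {V W : Type*} {G : SimpleGraph V}
    {G' : SimpleGraph W} {s t : ℕ} (h : G'.IsContained G) (hG : IsEmpty (SubdividedBiclique G s t)) :
    IsEmpty (SubdividedBiclique G' s t) :=
  ⟨fun B => not_nonempty_iff.2 hG (nonempty_subdividedBiclique (B.isContained.trans h))⟩

theorem exists_balanced_colouring (V : Type*) [Fintype V] {k : ℕ} (hk : 0 < k) :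
    ∃ φ : V → Fin k, ∀ i, ((Finset.univ.filter fun v => φ v = i).card) ≤ Fintype.card V / k + 1 := by
  classical
  let e := Fintype.equivFin V
  refine ⟨fun v => ⟨e v % k, Nat.mod_lt _ hk⟩, fun i => ?_⟩
  rw [← Finset.card_range (Fintype.card V / k + 1)]
  refine Finset.card_le_card_of_injOn (fun v => (e v : ℕ) / k) (fun v _ => ?_) fun u hu v hv h => ?_
  · rw [Finset.coe_range, Set.mem_Iio, Nat.lt_succ_iff]
    exact Nat.div_le_div_right (e v).2.le
  · have hu := congrArg Fin.val (Finset.mem_filter.1 hu).2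
    have hv := congrArg Fin.val (Finset.mem_filter.1 hv).2
    refine e.injective (Fin.ext ?_)
    simp only at h hu hv
    rw [← Nat.div_add_mod (e u) k, ← Nat.div_add_mod (e v) k, hu, hv, h]

/-- Graphs without a subdivided `K_{3,25}` have few edges: the vertices of large degree are removed
if they meet few edges, and otherwise a small set of vertices spans many edges. -/
theorem sum_degree_pow_le {C : ℕ} (hC : 8 * (10 ^ 6 * 1296 ^ 17) ^ 3 ≤ C) (n : ℕ) :
    ∀ (V : Type) [Fintype V] [DecidableEq V] (G : SimpleGraph V) [DecidableRel G.Adj],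
      Fintype.card V = n → IsEmpty (SubdividedBiclique G 3 25) →
      (∑ v, G.degree v) ^ 3 ≤ C * n ^ 4 := by
  induction n using Nat.strong_induction_on with
  | _ n ih =>
  intro V _ _ G _ hV hG
  obtain rfl | hn := n.eq_zero_or_pos
  · have := Fintype.card_eq_zero_iff.1 hV
    simp
  have : Nonempty V := Fintype.card_pos_iff.1 (hV ▸ hn)
  by_contra! hlt
  set s := ∑ v, G.degree v with hs
  have hs₀ : 0 < s := by
    by_contra! h
    have h0 : s = 0 := by omega
    rw [h0] at hlt
    simp at hlt
  -- `A` collects the vertices of degree above 648 times the average; by Markov's inequality it has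
  -- at most `n / 648` elements.
  let A : Finset V := Finset.univ.filter fun v => 648 * s < n * G.degree v
  have hA : A.card * 648 ≤ n := by
    have h1 : A.card * (648 * s) ≤ ∑ v ∈ A, n * G.degree v := by
      rw [← smul_eq_mul]
      exact Finset.card_nsmul_le_sum _ _ _ fun v hv => (Finset.mem_filter.1 hv).2.le
    have h2 : ∑ v ∈ A, n * G.degree v ≤ n * s := by
      rw [← Finset.mul_sum]
      exact Nat.mul_le_mul_left n (Finset.sum_le_sum_of_subset (Finset.subset_univ A))
    exact Nat.le_of_mul_le_mul_right (by linarith) hs₀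
  let G' : SimpleGraph V :=
    { Adj := fun u v => G.Adj u v ∧ u ∉ A ∧ v ∉ A
      symm := ⟨fun u v h => ⟨h.1.symm, h.2.2, h.2.1⟩⟩
      loopless := ⟨fun u h => G.loopless.irrefl u h.1⟩ }
  have : DecidableRel G'.Adj := fun u v => inferInstanceAs (Decidable (G.Adj u v ∧ u ∉ A ∧ v ∉ A))
  have hle : G' ≤ G := fun u v h => h.1
  by_cases hcase : s ≤ 2 * ∑ v, G'.degree v
  -- The graph `G'` keeps at least half of the degree sum, hence `1296 = 2 * 648`.
  · have h1 := sum_degree_pow_le_of_degree_le (G := G') (κ := 1296)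
      (isEmpty_subdividedBiclique_of_isContained (SimpleGraph.IsContained.of_le hle) hG)
      (by norm_num) fun v => by
        rw [hV]
        by_cases hv : v ∈ A
        · have : G'.degree v = 0 := by
            rw [SimpleGraph.degree_eq_zero]
            exact fun w h => h.2.1 hv
          rw [this]
          simp
        · have h1 : n * G.degree v ≤ 648 * s := by simpa [A] using hv
          have h2 : n * G'.degree v ≤ n * G.degree v :=
            Nat.mul_le_mul_left n (SimpleGraph.degree_le_of_le hle)
          linarith
    rw [hV] at h1
    have h2 : s ^ 3 ≤ C * n ^ 4 := calc
      s ^ 3 ≤ (2 * ∑ v, G'.degree v) ^ 3 := Nat.pow_le_pow_left hcase 3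
      _ = 8 * (∑ v, G'.degree v) ^ 3 := by ring
      _ ≤ 8 * ((10 ^ 6 * 1296 ^ 17) ^ 3 * n ^ 4) := Nat.mul_le_mul_left 8 h1
      _ = 8 * (10 ^ 6 * 1296 ^ 17) ^ 3 * n ^ 4 := by ring
      _ ≤ C * n ^ 4 := Nat.mul_le_mul_right _ hC
    exact absurd hlt (not_lt.2 h2)
  · push Not at hcase
    obtain ⟨φ, hφ⟩ := exists_balanced_colouring V (k := 648) (by norm_num)
    rw [hV] at hφ
    -- Every edge meeting `A` lies inside the `S i` given by the colour of its other endpoint, so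
    -- some `S i` spans a fair share of these edges.
    let S (i : Fin 648) : Finset V := A ∪ Finset.univ.filter fun v => φ v = i
    have hcover : s ≤ ∑ v, G'.degree v + ∑ i, ∑ u ∈ S i, ∑ v ∈ S i, if G.Adj u v then 1 else 0 := by
      have h1 : ∀ u v, (if G.Adj u v then 1 else 0) ≤ (if G'.Adj u v then 1 else 0) +
          ∑ i, if u ∈ S i then (if v ∈ S i then (if G.Adj u v then 1 else 0) else 0) else 0 := by
        intro u v
        by_cases huv : G.Adj u v
        · by_cases hA' : u ∉ A ∧ v ∉ A
          · rw [if_pos (show G'.Adj u v from ⟨huv, hA'⟩), if_pos huv]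
            exact Nat.le_add_right 1 _
          · obtain ⟨i, hu, hv⟩ : ∃ i, u ∈ S i ∧ v ∈ S i := by
              by_cases hu : u ∈ A
              · exact ⟨φ v, by simp [S, hu], by simp [S]⟩
              · have hv : v ∈ A := by tauto
                exact ⟨φ u, by simp [S], by simp [S, hv]⟩
            refine le_trans ?_ (Nat.le_add_left _ _)
            refine le_trans ?_ (Finset.single_le_sum (fun _ _ => Nat.zero_le _) (Finset.mem_univ i))
            rw [if_pos hu, if_pos hv]
        · simp [huv]
      have h2 : ∀ i, ∑ u ∈ S i, ∑ v ∈ S i, (if G.Adj u v then 1 else 0) =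
          ∑ u, ∑ v, if u ∈ S i then (if v ∈ S i then (if G.Adj u v then 1 else 0) else 0) else 0 := by
        intro i
        have h3 (f : V → ℕ) : ∑ u ∈ S i, f u = ∑ u, if u ∈ S i then f u else 0 := by
          rw [← Finset.sum_filter, Finset.filter_univ_mem]
        rw [h3]
        refine Finset.sum_congr rfl fun u _ => ?_
        split_ifs
        · exact h3 _
        · simp
      simp_rw [hs, sum_degree_eq, h2]
      exact sum_le_of_cover _ _ _ h1
    obtain ⟨i, hi⟩ : ∃ i, s < 2 * (648 * ∑ u ∈ S i, ∑ v ∈ S i, if G.Adj u v then 1 else 0) := by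
      by_contra! h
      have h1 := Finset.sum_le_sum fun i (_ : i ∈ (Finset.univ : Finset (Fin 648))) => h i
      rw [← Finset.mul_sum, ← Finset.mul_sum, Finset.sum_const, Finset.card_univ, Fintype.card_fin,
        smul_eq_mul] at h1
      omega
    -- This lets the rounding unit in the class sizes be absorbed into a third `n / 648`. Smaller
    -- `n` are covered by the size of `C`.
    have hn648 : 648 ≤ n := by
      by_contra! hsmall
      have h1 : s ≤ n * n := by
        rw [hs]
        refine (Finset.sum_le_card_nsmul _ _ n fun v _ => ?_).trans (by simp [hV])
        exact hV ▸ (G.degree_lt_card_verts v).le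
      have h2 : s ^ 3 ≤ C * n ^ 4 := calc
        s ^ 3 ≤ (n * n) ^ 3 := Nat.pow_le_pow_left h1 3
        _ = n ^ 2 * n ^ 4 := by ring
        _ ≤ C * n ^ 4 := Nat.mul_le_mul_right _ (le_trans (by nlinarith) hC)
      exact absurd hlt (not_lt.2 h2)
    have hcard : 648 * (S i).card ≤ 3 * n := by
      have h1 := Finset.card_union_le A (Finset.univ.filter fun v => φ v = i)
      have h2 := hφ i
      have h3 := Nat.div_mul_le_self n 648
      have h4 : (S i).card ≤ A.card + (Finset.univ.filter fun v => φ v = i).card := h1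
      omega
    have hih := ih (S i).card (by omega) {x // x ∈ S i} (G.comap Subtype.val) (by simp)
      (isEmpty_subdividedBiclique_of_isContained
        (SimpleGraph.Embedding.comap (Function.Embedding.subtype _) G).isContained hG)
    rw [sum_degree_eq] at hih
    have hsub : ∑ u : {x // x ∈ S i}, ∑ v : {x // x ∈ S i},
        (if (G.comap Subtype.val).Adj u v then 1 else 0) =
        ∑ u ∈ S i, ∑ v ∈ S i, if G.Adj u v then 1 else 0 := by
      simp only [SimpleGraph.comap_adj]
      rw [Finset.sum_coe_sort (S i) fun u => ∑ v : {x // x ∈ S i}, if G.Adj u v then 1 else 0]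
      exact Finset.sum_congr rfl fun u _ => Finset.sum_coe_sort (S i) fun v =>
        if G.Adj u v then 1 else 0
    rw [hsub] at hih
    generalize (∑ u ∈ S i, ∑ v ∈ S i, if G.Adj u v then 1 else 0) = q at *
    generalize (S i).card = m at *
    have h1 : s ^ 3 ≤ (2 * (648 * q)) ^ 3 := Nat.pow_le_pow_left hi.le 3
    have h2 : (648 * m) ^ 4 ≤ (3 * n) ^ 4 := Nat.pow_le_pow_left hcard 4
    have h3 : s ^ 3 ≤ C * n ^ 4 := by
      suffices h : 648 * s ^ 3 ≤ 648 * (C * n ^ 4) from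
        Nat.le_of_mul_le_mul_left h (by norm_num)
      calc 648 * s ^ 3 ≤ 648 * (2 * (648 * q)) ^ 3 := Nat.mul_le_mul_left _ h1
        _ = 8 * 648 ^ 4 * q ^ 3 := by ring
        _ ≤ 8 * 648 ^ 4 * (C * m ^ 4) := Nat.mul_le_mul_left _ hih
        _ = 8 * C * (648 * m) ^ 4 := by ring
        _ ≤ 8 * C * (3 * n) ^ 4 := Nat.mul_le_mul_left _ h2
        -- The choice of 648 is exactly `8 * 3 ^ 4`, so the induction closes with the same constant
        -- `C`.
        _ = 648 * (C * n ^ 4) := by ring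
    exact absurd hlt (not_lt.2 h3)

end Induction

/-! ### Passing to the extremal number. -/

theorem extremalNumber_upper_bound : ∃ C : ℝ, ∀ n : ℕ,
    (SimpleGraph.extremalNumber n (oneSubdivision (completeBipartiteGraph (Fin 3) (Fin 25))) : ℝ)
      ≤ C * (n : ℝ) ^ ((4 : ℝ) / 3) := by
  classical
  obtain ⟨C, hC⟩ : ∃ C : ℕ, 8 * (10 ^ 6 * 1296 ^ 17) ^ 3 ≤ C := ⟨_, le_rfl⟩
  refine ⟨C, fun n => ?_⟩
  have hC1 : (1 : ℝ) ≤ C := by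
    have : 1 ≤ C := le_trans (by norm_num) hC
    exact_mod_cast this
  conv_lhs => rw [← Fintype.card_fin n]
  have h0 : (0 : ℝ) ≤ C * (n : ℝ) ^ ((4 : ℝ) / 3) := by positivity
  rw [SimpleGraph.extremalNumber_le_iff_of_nonneg _ h0]
  intro G _ hfree
  have h1 := sum_degree_pow_le hC n (Fin n) G (by simp) ⟨fun B => hfree B.isContained⟩
  rw [SimpleGraph.sum_degrees_eq_twice_card_edges] at h1
  refine le_of_pow_le_pow_left₀ (n := 3) (by norm_num) h0 ?_
  have h2 : ((n : ℝ) ^ ((4 : ℝ) / 3)) ^ 3 = (n : ℝ) ^ 4 := by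
    rw [← Real.rpow_natCast, ← Real.rpow_mul (by positivity), ← Real.rpow_natCast]
    norm_num
  have h3 : ((2 * G.edgeFinset.card : ℕ) : ℝ) ^ 3 ≤ C * (n : ℝ) ^ 4 := by exact_mod_cast h1
  rw [mul_pow, h2]
  calc (G.edgeFinset.card : ℝ) ^ 3 ≤ ((2 * G.edgeFinset.card : ℕ) : ℝ) ^ 3 := by
        gcongr
        omega
    _ ≤ C * (n : ℝ) ^ 4 := h3
    -- Wasting `C ≤ C ^ 3` avoids taking a cube root of the constant.
    _ ≤ (C : ℝ) ^ 3 * (n : ℝ) ^ 4 := by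
        gcongr
        exact le_self_pow₀ hC1 (by norm_num)

/-- The extremal number of the `1`-subdivision of `K_{3,25}` has order of magnitude `n ^ (4/3)`. -/
theorem theorem1p2 :
    (fun n : ℕ =>
        (SimpleGraph.extremalNumber n
          (oneSubdivision (completeBipartiteGraph (Fin 3) (Fin 25))) : ℝ))
      =Θ[atTop] (fun n : ℕ => (n : ℝ) ^ ((4 : ℝ) / 3)) := by
  constructor
  · obtain ⟨C, hC⟩ := extremalNumber_upper_bound
    refine IsBigO.of_bound C (Eventually.of_forall fun n => ?_)
    rw [Real.norm_of_nonneg (Nat.cast_nonneg _), Real.norm_of_nonneg (by positivity)]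
    exact hC n
  · refine IsBigO.of_bound 2048 ((eventually_ge_atTop (32 ^ 3)).mono fun n hn => ?_)
    rw [Real.norm_of_nonneg (Nat.cast_nonneg _), Real.norm_of_nonneg (by positivity)]
    exact extremalNumber_lower_bound hn
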